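/- Let $N\ge 2$ and $\tau>0$. For a bounded domain (bounded, connected, nonempty open set) $\Omega\subset\mathbb{R}^N$ of class $C^1$, consider the Steklov problem for the biharmonic operator $$ \Delta^2u-\tau\Delta u=0 \ \text{in }\Omega,\qquad \frac{\partial^2u}{\partial\nu^2}=0,\quad \tau\frac{\partial u}{\partial\nu}-\operatorname{div}_{\partial\Omega}(D^2u\cdot\nu)-\frac{\partial\Delta u}{\partial\nu}=\lambda u\ \text{ on }\partial\Omega, $$ and let its fundamental tone $\lambda_2(\Omega)$ be defined by the Rayleigh principle $$ \lambda_2(\Omega)=\inf\left\{\frac{\int_\Omega |D^2u|^2+\tau|\nabla u|^2\,dx}{\int_{\partial\Omega}u^2\,d\sigma}\ :\ u\in H^2(\Omega),\ \int_{\partial\Omega}u\,d\sigma=0,\ \int_{\partial\Omega}u^2\,d\sigma\neq0\right\}, $$ where $\sigma$ is the $(N-1)$-dimensional surface measure on $\partial\Omega$, the values of $u$ on $\partial\Omega$ are understood in the sense of traces, and $|D^2u|^2=\sum_{i,j=1}^N(\partial^2u/\partial x_i\partial x_j)^2$. Among all bounded domains of class $C^1$ with fixed measure, the ball maximizes $\lambda_2$: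 if $\Omega\subset\mathbb{R}^N$ is a bounded domain of class $C^1$ and $\Omega^*\subset\mathbb{R}^N$ is an open ball with $|\Omega^*|=|\Omega|$, then $\Omega^*$ is itself a bounded domain of class $C^1$, and $$ \lambda_2(\Omega)\le\lambda_2(\Omega^*). $$ -/

import Mathlib

open MeasureTheory Filter Topology
open scoped ContDiff ENNReal

noncomputable section

namespace SteklovBiharmonic

/-- The space `ℝ^N` with its Euclidean norm. -/
abbrev E (N : ℕ) : Type := EuclideanSpace ℝ (Fin N)

/-- The `i`-th vector of the standard basis of `ℝ^N`. -/
def stdVec {N : ℕ} (i : Fin N) : E N := EuclideanSpace.single i (1 : ℝ)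

/-- The boundary of `Ω` is of class `C^1`: near each boundary point, in suitable orthonormal
coordinates (with `e` the direction of the last axis), `Ω` is the strict subgraph of a `C^1`
function `γ` of the other `N - 1` coordinates, that is, of a function on the hyperplane `eᗮ`. -/
def HasC1Boundary {N : ℕ} (Ω : Set (E N)) : Prop :=
  ∀ p ∈ frontier Ω, ∃ e : E N, ‖e‖ = 1 ∧
    ∃ γ : (ℝ ∙ e)ᗮ → ℝ, ContDiff ℝ 1 γ ∧
      ∃ ε : ℝ, 0 < ε ∧ ∀ x ∈ Metric.ball p ε,
        (x ∈ Ω ↔ inner ℝ e x < γ ((ℝ ∙ e)ᗮ.orthogonalProjectionOnto x))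

/-- A bounded domain (bounded, connected, open, nonempty set) of class `C^1`.
Nonemptiness is part of `IsConnected`. -/
structure IsBoundedC1Domain {N : ℕ} (Ω : Set (E N)) : Prop where
  isOpen : IsOpen Ω
  isConnected : IsConnected Ω
  isBounded : Bornology.IsBounded Ω
  hasC1Boundary : HasC1Boundary Ω

/-- The surface measure `σ` on `∂Ω`: the `(N-1)`-dimensional Hausdorff measure on `ℝ^N`
(normalized as usual, so that in dimension `d` it agrees with Lebesgue measure),
restricted to the boundary of `Ω`. -/
def surfaceMeasure {N : ℕ} (Ω : Set (E N)) : Measure (E N) :=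
  (μHE[N - 1] : Measure (E N)).restrict (frontier Ω)

/-- `v` is the weak partial derivative `∂u/∂x_i` of `u` in `Ω`. -/
def IsWeakPartialDeriv {N : ℕ} (Ω : Set (E N)) (i : Fin N) (u v : E N → ℝ) : Prop :=
  ∀ φ : E N → ℝ, ContDiff ℝ ∞ φ → HasCompactSupport φ → tsupport φ ⊆ Ω →
    ∫ x in Ω, u x * fderiv ℝ φ x (stdVec i) = - ∫ x in Ω, v x * φ x

/-- `u ∈ H²(Ω)`, with weak gradient `g = ∇u` and weak Hessian `h = D²u`. -/
structure IsH2 {N : ℕ} (Ω : Set (E N)) (u : E N → ℝ) (g : Fin N → E N → ℝ)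
    (h : Fin N → Fin N → E N → ℝ) : Prop where
  memLp : MemLp u 2 (volume.restrict Ω)
  memLp_grad : ∀ i, MemLp (g i) 2 (volume.restrict Ω)
  memLp_hess : ∀ i j, MemLp (h i j) 2 (volume.restrict Ω)
  grad : ∀ i, IsWeakPartialDeriv Ω i u (g i)
  hess : ∀ i j, IsWeakPartialDeriv Ω j (g i) (h i j)

/-- `t ∈ L²(∂Ω)` is the trace on `∂Ω` of `u`, a Sobolev function in `Ω` with weak gradient `g`.
The trace operator is the continuous extension to `H¹(Ω)` of the restriction to `∂Ω` of functions
that are smooth up to the boundary: there are `w_n ∈ C^∞(ℝ^N)` with `w_n → u` in `H¹(Ω)`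
and `w_n → t` in `L²(∂Ω)`. -/
def IsTrace {N : ℕ} (Ω : Set (E N)) (u : E N → ℝ) (g : Fin N → E N → ℝ)
    (t : E N → ℝ) : Prop :=
  MemLp t 2 (surfaceMeasure Ω) ∧
  ∃ w : ℕ → E N → ℝ, (∀ n, ContDiff ℝ ∞ (w n)) ∧
    Tendsto (fun n => eLpNorm (fun x => w n x - u x) 2 (volume.restrict Ω)) atTop (𝓝 0) ∧
    (∀ i, Tendsto (fun n => eLpNorm (fun x => fderiv ℝ (w n) x (stdVec i) - g i x) 2
      (volume.restrict Ω)) atTop (𝓝 0)) ∧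
    Tendsto (fun n => eLpNorm (fun x => w n x - t x) 2 (surfaceMeasure Ω)) atTop (𝓝 0)

/-- The values of the Rayleigh quotient
`(∫_Ω |D²u|² + τ |∇u|² dx) / (∫_{∂Ω} u² dσ)` over the `u ∈ H²(Ω)` with `∫_{∂Ω} u dσ = 0`
and nonzero denominator, the values of `u` on `∂Ω` being those of its trace `t`. -/
def rayleighQuotients {N : ℕ} (τ : ℝ) (Ω : Set (E N)) : Set ℝ :=
  {q | ∃ (u : E N → ℝ) (g : Fin N → E N → ℝ) (h : Fin N → Fin N → E N → ℝ) (t : E N → ℝ),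
    IsH2 Ω u g h ∧ IsTrace Ω u g t ∧
    ∫ x, t x ∂(surfaceMeasure Ω) = 0 ∧
    ∫ x, (t x) ^ 2 ∂(surfaceMeasure Ω) ≠ 0 ∧
    q = (∫ x in Ω, ((∑ i, ∑ j, (h i j x) ^ 2) + τ * ∑ i, (g i x) ^ 2)) /
          ∫ x, (t x) ^ 2 ∂(surfaceMeasure Ω)}

/-- The fundamental tone `λ₂(Ω)` of the biharmonic Steklov problem with tension `τ > 0`,
given by the Rayleigh principle. -/
def fundamentalTone {N : ℕ} (τ : ℝ) (Ω : Set (E N)) : ℝ :=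
  sInf (rayleighQuotients τ Ω)

end SteklovBiharmonic

end

/-!
The proof compares both fundamental tones with `τ / r`, where `r` is the radius of the ball `B`.

*Upper bound on `Ω`.* The coordinate functions `xᵢ - aᵢ`, with `a` the barycentre of `∂Ω`, are
admissible and have vanishing Hessian. Adding up their Rayleigh quotients gives
`λ₂(Ω) ∫_{∂Ω} |x - a|² dσ ≤ N τ |Ω|` (`fundamentalTone_le`), and the weighted isoperimetric
inequality `∫_{∂Ω} |x - a|² dσ ≥ r N |Ω|` (`mul_volume_le_integral_norm_sq`) finishes. The latter is
proved by calibration: there is a smooth field `F` with `|F| ≤ |x - a|²`, with equality and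
`F` normal on the sphere of radius `r`, whose divergence increases with `|x - a|`, so that
`∫_{∂Ω} |x - a|² ≥ ∫_Ω div F ≥ ∫_{B(a, r)} div F = r N |B|`.

*Lower bound on `B`.* Dropping the Hessian, it suffices to have the Steklov inequality
`∫_{∂B} w² ≤ r ∫_B |∇w|²` for `w` of mean zero on `∂B` (`steklov_ball`). Polynomials are dense on
the sphere and agree there with harmonic ones, so one finds a harmonic polynomial `h` for which
`v = x · ∇h` is close to `w` on `∂B`. Green's formula gives
`r ∫_B |∇w|² ≥ 2 ∫_{∂B} w v - r ∫_B |∇h|²`, and `r ∫_B |∇h|² ≤ ∫_{∂B} v²` by Rellich's identity and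
the subharmonicity of `|∇h|²` (`integral_gradSq_le`). A limit extends the inequality to traces.

*Surface measure.* The divergence theorem is needed only as the inequality
`∫_Ω div F ≤ ∫_{∂Ω} |F| dσ` (`integral_divergence_le`), which requires neither normals nor an area
formula: after localization `F` is nearly constant, and in a direction `b` along which `Ω` is
locally monotone the flux of `f b` is computed by Fubini on lines and bounded because orthogonal
projections do not increase Hausdorff measure (`monotone_flux`). On the ball this inequality
self-improves to the divergence theorem (`integral_sphere_eq`): apply it to `F + M (x - c)` and let
`M → ∞`, using `r σ(∂B) ≤ N |B|` (`surfaceMeasure_ball_le`), which follows by comparing small caps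
with their central projections to tangent hyperplanes.
-/

noncomputable section

namespace SteklovBiharmonic

/-! ### Slicing along a direction -/

theorem euclideanHausdorffMeasure_image_le {X Y : Type*} [EMetricSpace X] [MeasurableSpace X]
    [BorelSpace X] [EMetricSpace Y] [MeasurableSpace Y] [BorelSpace Y] {K : NNReal} {f : X → Y}
    {s : Set X} (hf : LipschitzOnWith K f s) (d : ℕ) :
    μHE[d] (f '' s) ≤ (K : ℝ≥0∞) ^ d * μHE[d] s := by
  have h := hf.hausdorffMeasure_image_le (d := (d : ℝ)) (by positivity)
  rw [ENNReal.rpow_natCast] at h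
  rw [Measure.euclideanHausdorffMeasure_def, Measure.euclideanHausdorffMeasure_def,
    Measure.smul_apply, Measure.smul_apply, mul_smul_comm]
  gcongr

theorem finrank_orthogonal_span {N : ℕ} {b : E N} (hb : ‖b‖ = 1) :
    Module.finrank ℝ (ℝ ∙ b)ᗮ = N - 1 := by
  have hb0 : b ≠ 0 := by
    rintro rfl
    simp at hb
  have h1 := (ℝ ∙ b).finrank_add_finrank_orthogonal
  rw [finrank_span_singleton hb0, finrank_euclideanSpace_fin] at h1
  omega

/-- On the hyperplane `bᗮ` Lebesgue measure is the `(N-1)`-dimensional Hausdorff measure. -/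
theorem volume_orthogonal_eq {N : ℕ} {b : E N} (hb : ‖b‖ = 1) :
    (volume : Measure (ℝ ∙ b)ᗮ) = μHE[N - 1] := by
  rw [← finrank_orthogonal_span hb, InnerProductSpace.euclideanHausdorffMeasure_eq_volume]

theorem volume_image_orthogonalProjection_le {N : ℕ} {b : E N} (hb : ‖b‖ = 1) (A : Set (E N)) :
    volume ((ℝ ∙ b)ᗮ.orthogonalProjectionOnto '' A) ≤ μHE[N - 1] A := by
  rw [volume_orthogonal_eq hb]
  have hL : LipschitzWith 1 ((ℝ ∙ b)ᗮ.orthogonalProjectionOnto : E N → (ℝ ∙ b)ᗮ) :=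
    (ContinuousLinearMap.lipschitz _).weaken
      (by exact_mod_cast (ℝ ∙ b)ᗮ.orthogonalProjectionOnto_norm_le)
  simpa using euclideanHausdorffMeasure_image_le (hL.lipschitzOnWith (s := A)) (N - 1)

/-- The coordinates `(t, z) ↦ t b + z` along and across a unit vector `b`. -/
def sliceMap {N : ℕ} (b : E N) (q : ℝ × (ℝ ∙ b)ᗮ) : E N := q.1 • b + (q.2 : E N)

theorem measurePreserving_sliceMap {N : ℕ} {b : E N} (hb : ‖b‖ = 1) :
    MeasurePreserving (sliceMap b) volume volume := by
  have h1 : MeasurePreserving (Prod.map (LinearIsometryEquiv.toSpanUnitSingleton (𝕜 := ℝ) b hb)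
      (id : (ℝ ∙ b)ᗮ → (ℝ ∙ b)ᗮ)) (volume.prod volume) (volume.prod volume) :=
    (LinearIsometryEquiv.measurePreserving _).prod (MeasurePreserving.id _)
  have h2 := (WithLp.volume_preserving_toLp (ℝ ∙ b) (ℝ ∙ b)ᗮ).comp h1
  have h3 := ((ℝ ∙ b).orthogonalDecomposition.symm.measurePreserving).comp h2
  convert! h3 using 1

theorem measurableEmbedding_sliceMap {N : ℕ} {b : E N} (hb : ‖b‖ = 1) :
    MeasurableEmbedding (sliceMap b) := by
  have hinj : Function.Injective (sliceMap b) := by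
    rintro ⟨t, z⟩ ⟨t', z'⟩ h
    simp only [sliceMap] at h
    have hz : ∀ z : (ℝ ∙ b)ᗮ, inner ℝ b (z : E N) = 0 := fun z =>
      Submodule.mem_orthogonal_singleton_iff_inner_right.1 z.2
    have h1 := congrArg (fun x => inner ℝ b x) h
    simp only [inner_add_right, inner_smul_right, hz, real_inner_self_eq_norm_sq, hb] at h1
    have ht : t = t' := by linarith
    subst ht
    have h2 : (z : E N) = z' := by simpa using h
    exact Prod.ext rfl (Subtype.ext h2)
  have hc : Continuous (sliceMap b) := by unfold sliceMap; fun_prop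
  exact hc.measurableEmbedding hinj

theorem proj_sliceMap {N : ℕ} (b : E N) (q : ℝ × (ℝ ∙ b)ᗮ) :
    (ℝ ∙ b)ᗮ.orthogonalProjectionOnto (sliceMap b q) = q.2 := by
  have : (ℝ ∙ b)ᗮ.orthogonalProjectionOnto b = 0 :=
    Submodule.orthogonalProjectionOnto_orthogonalComplement_singleton_eq_zero b
  simp [sliceMap, this]

/-- If `T` is downward closed inside the interval `U` and `g` lives in `U`, then `∫_T g'` is the
value of `g` at the point where one leaves `T`, if there is one, and vanishes otherwise. -/
theorem setIntegral_deriv_eq_exit_value {T U : Set ℝ} (hT : IsOpen T) (hU : IsOpen U)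
    (hUc : U.OrdConnected) {g : ℝ → ℝ} (hg : ContDiff ℝ 1 g) (hgc : HasCompactSupport g)
    (hgU : tsupport g ⊆ U) (hmono : ∀ s ∈ T ∩ U, ∀ s' ≤ s, s' ∈ U → s' ∈ T) :
    ∫ s in T, deriv g s = 0 ∨ ∃ s ∈ frontier T, ∫ s in T, deriv g s = g s := by
  have hd : ∀ s, s ∉ U → deriv g s = 0 := fun s hs => by
    by_contra h
    exact hs (hgU (support_deriv_subset h))
  have hcongr : ∀ T' : Set ℝ, IsOpen T' → T ∩ U = T' ∩ U →
      ∫ s in T, deriv g s = ∫ s in T', deriv g s := by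
    intro T' hT' h
    rw [← integral_indicator hT.measurableSet, ← integral_indicator hT'.measurableSet]
    congr 1
    ext s
    by_cases hs : s ∈ U
    · have : s ∈ T ↔ s ∈ T' := ⟨fun h1 => (h ▸ (⟨h1, hs⟩ : s ∈ T ∩ U) : s ∈ T' ∩ U).1,
        fun h1 => (h ▸ (⟨h1, hs⟩ : s ∈ T' ∩ U) : s ∈ T ∩ U).1⟩
      by_cases h1 : s ∈ T
      · simp [h1, this.1 h1]
      · rw [Set.indicator_of_notMem h1, Set.indicator_of_notMem fun h2 => h1 (this.2 h2)]
    · simp [Set.indicator, hd s hs]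
  rcases (T ∩ U).eq_empty_or_nonempty with hE | ⟨a, ha⟩
  · left
    rw [hcongr ∅ isOpen_empty (by simpa using hE)]
    simp
  by_cases hUT : U ⊆ T
  · left
    rw [hcongr Set.univ isOpen_univ (by simpa using Set.inter_eq_self_of_subset_right hUT)]
    rw [setIntegral_univ]
    exact integral_eq_zero_of_hasDerivAt_of_integrable
      (fun x => (hg.differentiable one_ne_zero x).hasDerivAt)
      ((hg.continuous_deriv le_rfl).integrable_of_hasCompactSupport hgc.deriv)
      (hg.continuous.integrable_of_hasCompactSupport hgc)
  obtain ⟨u, huU, huT⟩ := Set.not_subset.1 hUT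
  right
  have hbd : ∀ s ∈ T ∩ U, s ≤ u := fun s hs => by
    by_contra h
    exact huT (hmono s hs u (not_le.1 h).le huU)
  have hB : BddAbove (T ∩ U) := ⟨u, hbd⟩
  set s0 := sSup (T ∩ U) with hs0
  have has0 : a ≤ s0 := le_csSup hB ha
  have hs0u : s0 ≤ u := csSup_le ⟨a, ha⟩ hbd
  have hs0U : s0 ∈ U := hUc.out ha.2 huU ⟨has0, hs0u⟩
  have hs0T : s0 ∉ T := by
    intro h
    obtain ⟨ε, hε, hball⟩ := Metric.isOpen_iff.1 (hT.inter hU) s0 ⟨h, hs0U⟩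
    have h1 : s0 + ε / 2 ∈ T ∩ U := hball (by
      rw [Metric.mem_ball, Real.dist_eq, add_sub_cancel_left, abs_of_pos (by positivity)]
      linarith)
    have := le_csSup hB h1
    linarith
  have hset : T ∩ U = Set.Iio s0 ∩ U := by
    ext s
    constructor
    · rintro hs
      refine ⟨lt_of_le_of_ne (le_csSup hB hs) ?_, hs.2⟩
      rintro rfl
      exact hs0T hs.1
    · rintro ⟨h1, h2⟩
      obtain ⟨s1, hs1, hlt⟩ := exists_lt_of_lt_csSup ⟨a, ha⟩ h1
      exact ⟨hmono s1 hs1 s hlt.le h2, h2⟩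
  refine ⟨s0, ⟨?_, fun h => hs0T (interior_subset h)⟩, ?_⟩
  · exact closure_mono Set.inter_subset_left (csSup_mem_closure ⟨a, ha⟩ hB)
  · rw [hcongr _ isOpen_Iio hset, ← integral_Iic_eq_integral_Iio, hgc.integral_Iic_deriv_eq hg]

theorem integral_fderiv_apply_eq_zero {N : ℕ} {f : E N → ℝ} (hf : ContDiff ℝ 1 f)
    (hfc : HasCompactSupport f) (b : E N) : ∫ x, fderiv ℝ f x b = 0 := by
  have h := integral_mul_fderiv_eq_neg_fderiv_mul_of_integrable (μ := (volume : Measure (E N)))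
    (f := fun _ => (1 : ℝ)) (g := f) (v := b) (by simp)
    (by simpa using ((hf.continuous_fderiv one_ne_zero).clm_apply
      continuous_const).integrable_of_hasCompactSupport (hfc.fderiv_apply (𝕜 := ℝ) b))
    (by simpa using hf.continuous.integrable_of_hasCompactSupport hfc)
    (fun x _ => by fun_prop) (fun x _ => hf.differentiable one_ne_zero x)
  simpa using h

/-- If `Ω` is, inside a convex open set `U`, monotone in the direction `-b`, then the flux of
`f b` through `∂Ω` (for `f ≥ 0` supported in `U`) is nonnegative and at most `∫_{∂Ω} f dσ`. -/
theorem monotone_flux {N : ℕ} {Ω U : Set (E N)} {b : E N} (hb : ‖b‖ = 1) (hΩ : IsOpen Ω)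
    [IsFiniteMeasure (surfaceMeasure Ω)] (hU : IsOpen U) (hUc : Convex ℝ U)
    (hmono : ∀ x ∈ Ω ∩ U, ∀ t : ℝ, 0 ≤ t → x - t • b ∈ U → x - t • b ∈ Ω)
    {f : E N → ℝ} (hf : ContDiff ℝ 1 f) (hfc : HasCompactSupport f) (hfU : tsupport f ⊆ U)
    (hf0 : ∀ x, 0 ≤ f x) :
    0 ≤ ∫ x in Ω, fderiv ℝ f x b ∧
      ∫ x in Ω, fderiv ℝ f x b ≤ ∫ x, f x ∂(surfaceMeasure Ω) := by
  set F : E N → ℝ := Ω.indicator (fun x => fderiv ℝ f x b) with hF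
  have hFint : Integrable F := by
    refine Integrable.indicator ?_ hΩ.measurableSet
    exact ((hf.continuous_fderiv one_ne_zero).clm_apply
      continuous_const).integrable_of_hasCompactSupport (hfc.fderiv_apply (𝕜 := ℝ) b)
  have hFint' : Integrable (fun q : ℝ × (ℝ ∙ b)ᗮ => F (sliceMap b q)) (volume.prod volume) :=
    ((measurePreserving_sliceMap hb).integrable_comp_emb
      (measurableEmbedding_sliceMap hb)).2 hFint
  set G : (ℝ ∙ b)ᗮ → ℝ := fun z => ∫ t, F (sliceMap b (t, z)) with hG
  have hGint : Integrable G := hFint'.integral_prod_right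
  have hFG : ∫ x in Ω, fderiv ℝ f x b = ∫ z, G z := by
    rw [← integral_indicator hΩ.measurableSet, ← hF,
      ← (measurePreserving_sliceMap hb).integral_comp (measurableEmbedding_sliceMap hb)]
    exact integral_prod_symm _ hFint'
  -- on each line the integral is the value of `f` at a boundary point, or zero
  have hexit : ∀ z, G z = 0 ∨
      ∃ s : ℝ, sliceMap b (s, z) ∈ frontier Ω ∧ G z = f (sliceMap b (s, z)) := by
    intro z
    set l : ℝ → E N := fun t => sliceMap b (t, z) with hl
    have hlc : Continuous l := by simp only [hl, sliceMap]; fun_prop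
    have hld : ∀ t, HasDerivAt l b t := fun t => by
      simpa [hl, sliceMap] using ((hasDerivAt_id t).smul_const b).add_const (z : E N)
    have hlC : ContDiff ℝ 1 l := by simp only [hl, sliceMap]; fun_prop
    have hliso : Isometry l := by
      refine Isometry.of_dist_eq fun s t => ?_
      simp only [hl, sliceMap, dist_add_right]
      rw [dist_eq_norm, ← sub_smul, norm_smul, hb, mul_one, dist_eq_norm]
    have hder : ∀ t, deriv (f ∘ l) t = fderiv ℝ f (l t) b := fun t =>
      (((hf.differentiable one_ne_zero (l t)).hasFDerivAt).comp_hasDerivAt t (hld t)).deriv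
    have hGz : G z = ∫ t in l ⁻¹' Ω, deriv (f ∘ l) t := by
      rw [← integral_indicator (hΩ.preimage hlc).measurableSet]
      refine integral_congr_ae (Eventually.of_forall fun t => ?_)
      by_cases ht : l t ∈ Ω
      · have ht' : t ∈ l ⁻¹' Ω := ht
        rw [Set.indicator_of_mem ht', hder]
        exact Set.indicator_of_mem ht _
      · have ht' : t ∉ l ⁻¹' Ω := ht
        rw [Set.indicator_of_notMem ht']
        exact Set.indicator_of_notMem ht _
    have hord : (l ⁻¹' U).OrdConnected := by
      have : Convex ℝ (l ⁻¹' U) := by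
        have h2 : l = fun t : ℝ => (LinearMap.toSpanSingleton ℝ (E N) b) t + (z : E N) := by
          ext1 t; simp [hl, sliceMap]
        have h3 := (hUc.translate_preimage_left (z : E N)).linear_preimage
          (LinearMap.toSpanSingleton ℝ (E N) b)
        convert! h3 using 1
      exact this.ordConnected
    rcases setIntegral_deriv_eq_exit_value (g := f ∘ l) (hΩ.preimage hlc)
      (hU.preimage hlc) hord (hf.comp hlC)
      (hfc.comp_isClosedEmbedding hliso.isClosedEmbedding)
      ((tsupport_comp_subset_preimage f hlc).trans (Set.preimage_mono hfU)) (by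
        rintro s ⟨hs1, hs2⟩ s' hs' hs'U
        have e1 : l s - (s - s') • b = l s' := by
          simp only [hl, sliceMap, sub_smul]; abel
        have := hmono (l s) ⟨hs1, hs2⟩ (s - s') (by linarith) (by rw [e1]; exact hs'U)
        rw [e1] at this
        exact this) with h | ⟨s, hs, h⟩
    · exact Or.inl (hGz.trans h)
    · exact Or.inr ⟨s, hlc.frontier_preimage_subset Ω hs, hGz.trans h⟩
  have hG0 : ∀ z, 0 ≤ G z := fun z => by
    rcases hexit z with h | ⟨s, -, h⟩
    · exact h.ge
    · rw [h]; exact hf0 _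
  rw [hFG]
  refine ⟨integral_nonneg hG0, ?_⟩
  have hfint : Integrable f (surfaceMeasure Ω) :=
    hf.continuous.integrable_of_hasCompactSupport hfc
  rw [integral_eq_lintegral_of_nonneg_ae (Eventually.of_forall hG0) hGint.aestronglyMeasurable,
    integral_eq_lintegral_of_nonneg_ae (Eventually.of_forall hf0) hfint.aestronglyMeasurable]
  -- layer cake: the set `{G > t}` is covered by the projection of `{f > t} ∩ ∂Ω`; no measurable
  -- choice of the boundary point is needed
  refine ENNReal.toReal_mono hfint.lintegral_lt_top.ne ?_
  rw [lintegral_eq_lintegral_meas_lt _ (Eventually.of_forall hG0) hGint.aemeasurable,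
    lintegral_eq_lintegral_meas_lt _ (Eventually.of_forall hf0) hfint.aemeasurable]
  refine setLIntegral_mono' measurableSet_Ioi fun t ht => ?_
  have hmeas : MeasurableSet {x | t < f x} :=
    (isOpen_lt continuous_const hf.continuous).measurableSet
  rw [surfaceMeasure, Measure.restrict_apply hmeas]
  refine le_trans (measure_mono ?_) (volume_image_orthogonalProjection_le hb _)
  intro z hz
  rcases hexit z with h | ⟨s, hs, h⟩
  · have hz' : t < G z := hz
    exact absurd (lt_trans (Set.mem_Ioi.1 ht) hz') (by rw [h]; exact lt_irrefl _)
  · exact ⟨sliceMap b (s, z), ⟨by simpa [h] using hz, hs⟩, proj_sliceMap b _⟩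

/-! ### Charts and local flux bounds -/

/-- Near a boundary point `Ω` is the sublevel set of a `C^1` function `ψ` with nonzero
derivative. -/
theorem HasC1Boundary.exists_chart {N : ℕ} {Ω : Set (E N)} (h : HasC1Boundary Ω) {p : E N}
    (hp : p ∈ frontier Ω) : ∃ (e : E N) (ψ : E N → ℝ), ‖e‖ = 1 ∧ ContDiff ℝ 1 ψ ∧
      fderiv ℝ ψ p e = 1 ∧ ∃ ε : ℝ, 0 < ε ∧ ∀ x ∈ Metric.ball p ε, (x ∈ Ω ↔ ψ x < 0) := by
  obtain ⟨e, he, γ, hγ, ε, hε, hx⟩ := h p hp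
  refine ⟨e, fun x => inner ℝ e x - γ ((ℝ ∙ e)ᗮ.orthogonalProjectionOnto x), he, ?_, ?_, ε, hε,
    fun x hxp => by rw [hx x hxp, sub_neg]⟩
  · exact (contDiff_const.inner ℝ contDiff_id).sub (hγ.comp (ContinuousLinearMap.contDiff _))
  · have h1 : HasFDerivAt (fun x : E N => inner ℝ e x) (innerSL ℝ e) p :=
      (innerSL ℝ e).hasFDerivAt
    have h2 : HasFDerivAt (fun x : E N => γ ((ℝ ∙ e)ᗮ.orthogonalProjectionOnto x)) _ p :=
      ((hγ.differentiable one_ne_zero _).hasFDerivAt).comp p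
        ((ℝ ∙ e)ᗮ.orthogonalProjectionOnto).hasFDerivAt
    rw [(h1.fun_sub h2).fderiv]
    have : (ℝ ∙ e)ᗮ.orthogonalProjectionOnto e = 0 :=
      Submodule.orthogonalProjectionOnto_orthogonalComplement_singleton_eq_zero e
    simp [this, he]

/-- Near each of its points the boundary has finite area, being there the image of a ball of the
hyperplane under a Lipschitz graph map. -/
theorem HasC1Boundary.finiteAtFilter {N : ℕ} {Ω : Set (E N)} (h : HasC1Boundary Ω)
    (hΩ : IsOpen Ω) {p : E N} (hp : p ∈ frontier Ω) :
    (μHE[N - 1] : Measure (E N)).FiniteAtFilter (𝓝[frontier Ω] p) := by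
  obtain ⟨e, he, γ, hγ, ε, hε, hx⟩ := h p hp
  set P := (ℝ ∙ e)ᗮ.orthogonalProjectionOnto with hP
  set Γ : (ℝ ∙ e)ᗮ → E N := fun z => γ z • e + (z : E N) with hΓdef
  have hΓ : ContDiff ℝ 1 Γ := (hγ.smul contDiff_const).add
    ((ℝ ∙ e)ᗮ.subtypeL.contDiff)
  obtain ⟨K, s, hs, hK⟩ := (hΓ.contDiffAt (x := P p)).exists_lipschitzOnWith
  have hs' : s ∩ Metric.ball (P p) 1 ∈ 𝓝 (P p) := inter_mem hs (Metric.ball_mem_nhds _ one_pos)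
  have hpre : P ⁻¹' (s ∩ Metric.ball (P p) 1) ∩ Metric.ball p ε ∈ 𝓝 p :=
    inter_mem (P.continuous.continuousAt hs') (Metric.ball_mem_nhds _ hε)
  refine ⟨frontier Ω ∩ (P ⁻¹' (s ∩ Metric.ball (P p) 1) ∩ Metric.ball p ε),
    inter_mem_nhdsWithin _ hpre, ?_⟩
  refine lt_of_le_of_lt (measure_mono (t := Γ '' (s ∩ Metric.ball (P p) 1)) ?_)
    (lt_of_le_of_lt (euclideanHausdorffMeasure_image_le (hK.mono Set.inter_subset_left) _) ?_)
  · rintro x ⟨hxf, hxs, hxb⟩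
    refine ⟨P x, hxs, ?_⟩
    have hdec : x = (inner ℝ e x : ℝ) • e + (P x : E N) := by
      have h1 := (ℝ ∙ e).starProjection_add_starProjection_orthogonal x
      rw [Submodule.starProjection_unit_singleton ℝ he] at h1
      exact h1.symm
    have hcont : Continuous fun y : E N => inner ℝ e y - γ (P y) :=
      (continuous_const.inner continuous_id).sub (hγ.continuous.comp P.continuous)
    have h1 : ¬ inner ℝ e x < γ (P x) := fun hlt =>
      (hΩ.frontier_eq ▸ hxf : x ∈ closure Ω \ Ω).2 ((hx x hxb).2 hlt)
    have h2 : ¬ 0 < inner ℝ e x - γ (P x) := fun hlt => by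
      have hV : IsOpen ({y : E N | 0 < inner ℝ e y - γ (P y)} ∩ Metric.ball p ε) :=
        (isOpen_lt continuous_const hcont).inter Metric.isOpen_ball
      obtain ⟨y, ⟨hy1, hy2⟩, hy3⟩ := mem_closure_iff.1 hxf.1 _ hV ⟨hlt, hxb⟩
      have := (hx y hy2).1 hy3
      have hy1' : 0 < inner ℝ e y - γ (P y) := hy1
      linarith
    have h3 : γ (P x) = inner ℝ e x := by linarith
    simp only [hΓdef]
    rw [h3]
    exact hdec.symm
  · rw [← volume_orthogonal_eq he]
    refine ENNReal.mul_lt_top (by finiteness) ?_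
    exact lt_of_le_of_lt (measure_mono Set.inter_subset_right) Metric.isBounded_ball.measure_lt_top

theorem IsBoundedC1Domain.isFiniteMeasure {N : ℕ} {Ω : Set (E N)} (h : IsBoundedC1Domain Ω) :
    IsFiniteMeasure (surfaceMeasure Ω) := by
  have hc : IsCompact (frontier Ω) :=
    Metric.isCompact_of_isClosed_isBounded isClosed_frontier
      (h.isBounded.closure.subset frontier_subset_closure)
  refine ⟨?_⟩
  rw [surfaceMeasure, Measure.restrict_apply_univ]
  exact hc.measure_lt_top_of_nhdsWithin fun p hp => h.hasC1Boundary.finiteAtFilter h.isOpen hp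

/-- Directions in which the chart function `ψ` increases at `p` are directions of monotonicity
of `{ψ < 0}` near `p`. -/
theorem exists_ball_monotone {N : ℕ} {Ω : Set (E N)} {ψ : E N → ℝ} (hψ : ContDiff ℝ 1 ψ)
    {p b : E N} (hb : 0 < fderiv ℝ ψ p b) {ε : ℝ} (hε : 0 < ε)
    (hx : ∀ x ∈ Metric.ball p ε, (x ∈ Ω ↔ ψ x < 0)) :
    ∃ ρ > 0, ∀ ρ' ≤ ρ, ∀ x ∈ Ω ∩ Metric.ball p ρ', ∀ t : ℝ, 0 ≤ t →
      x - t • b ∈ Metric.ball p ρ' → x - t • b ∈ Ω := by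
  have hcont : Continuous fun x => fderiv ℝ ψ x b :=
    (hψ.continuous_fderiv one_ne_zero).clm_apply continuous_const
  obtain ⟨δ, hδ, hball⟩ := Metric.isOpen_iff.1 (isOpen_lt continuous_const hcont) p hb
  refine ⟨min δ ε, lt_min hδ hε, ?_⟩
  rintro ρ' hρ' x ⟨hxΩ, hxp⟩ t ht hxt
  have hsub1 : Metric.ball p ρ' ⊆ Metric.ball p ε :=
    Metric.ball_subset_ball (hρ'.trans (min_le_right _ _))
  have hsub2 : Metric.ball p ρ' ⊆ Metric.ball p δ :=
    Metric.ball_subset_ball (hρ'.trans (min_le_left _ _))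
  refine (hx _ (hsub1 hxt)).2 (lt_of_le_of_lt ?_ ((hx _ (hsub1 hxp)).1 hxΩ))
  have hder : ∀ s : ℝ, HasDerivAt (fun s : ℝ => ψ (x - s • b)) (-(fderiv ℝ ψ (x - s • b) b)) s := by
    intro s
    have h1 : HasDerivAt (fun s : ℝ => x - s • b) (-b) s := by
      simpa using ((hasDerivAt_id s).smul_const b).const_sub x
    have h2 := ((hψ.differentiable one_ne_zero (x - s • b)).hasFDerivAt).comp_hasDerivAt s h1
    rw [map_neg] at h2
    exact h2
  have hanti : AntitoneOn (fun s : ℝ => ψ (x - s • b)) (Set.Icc 0 t) := by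
    refine antitoneOn_of_deriv_nonpos (convex_Icc 0 t)
      (fun s _ => (hder s).continuousAt.continuousWithinAt)
      (fun s _ => (hder s).differentiableAt.differentiableWithinAt) fun s hs => ?_
    rw [interior_Icc] at hs
    rw [(hder s).deriv, neg_nonpos]
    have hmem : x - s • b ∈ Metric.ball p ρ' := by
      have h0 : s / t ∈ Set.Icc (0 : ℝ) 1 :=
        ⟨div_nonneg hs.1.le ht, div_le_one_of_le₀ hs.2.le ht⟩
      have := (convex_ball p ρ').add_smul_sub_mem hxp hxt h0
      have ht0 : t ≠ 0 := (hs.1.trans hs.2).ne'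
      convert! this using 1
      rw [sub_sub_cancel_left, smul_neg, smul_smul, div_mul_cancel₀ _ ht0, sub_eq_add_neg]
    exact le_of_lt (hball (hsub2 hmem))
  simpa using hanti (Set.left_mem_Icc.2 ht) (Set.right_mem_Icc.2 ht) ht

theorem monotone_flux_smul {N : ℕ} {Ω U : Set (E N)} {b : E N} (hb : b ≠ 0) (hΩ : IsOpen Ω)
    [IsFiniteMeasure (surfaceMeasure Ω)] (hU : IsOpen U) (hUc : Convex ℝ U)
    (hmono : ∀ x ∈ Ω ∩ U, ∀ t : ℝ, 0 ≤ t → x - t • b ∈ U → x - t • b ∈ Ω)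
    {f : E N → ℝ} (hf : ContDiff ℝ 1 f) (hfc : HasCompactSupport f) (hfU : tsupport f ⊆ U)
    (hf0 : ∀ x, 0 ≤ f x) :
    0 ≤ ∫ x in Ω, fderiv ℝ f x b ∧
      ∫ x in Ω, fderiv ℝ f x b ≤ ‖b‖ * ∫ x, f x ∂(surfaceMeasure Ω) := by
  have hb' : 0 < ‖b‖ := norm_pos_iff.2 hb
  have hunit : ‖(‖b‖⁻¹ : ℝ) • b‖ = 1 := by
    rw [norm_smul, norm_inv, norm_norm, inv_mul_cancel₀ hb'.ne']
  have h := monotone_flux hunit hΩ hU hUc (fun x hx t ht => by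
    rw [smul_smul]
    exact hmono x hx _ (by positivity)) hf hfc hfU hf0
  simp only [map_smul, smul_eq_mul, integral_const_mul] at h
  rw [inv_mul_le_iff₀ hb'] at h
  exact ⟨(mul_nonneg_iff_of_pos_left (inv_pos.2 hb')).1 h.1, h.2⟩

theorem integrable_fderiv_apply {N : ℕ} {f : E N → ℝ} (hf : ContDiff ℝ 1 f)
    (hfc : HasCompactSupport f) (b : E N) : Integrable fun x => fderiv ℝ f x b :=
  ((hf.continuous_fderiv one_ne_zero).clm_apply
      continuous_const).integrable_of_hasCompactSupport (hfc.fderiv_apply (𝕜 := ℝ) b)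

/-- The flux of `f a`, for a constant vector `a` and `f ≥ 0` concentrated near `p`, is at most
`(‖a‖ + η) ∫_{∂Ω} f dσ`. The normal vector does not enter: after a small perturbation either `a`
or `-a` is a direction of monotonicity of `Ω` near `p`. -/
theorem exists_local_flux_le {N : ℕ} {Ω : Set (E N)} (h : IsBoundedC1Domain Ω) {p : E N}
    (hp : p ∈ closure Ω) (a : E N) {η : ℝ} (hη : 0 < η) :
    ∃ ρ > 0, ∀ f : E N → ℝ, ContDiff ℝ 1 f → (∀ x, 0 ≤ f x) → tsupport f ⊆ Metric.ball p ρ →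
      ∫ x in Ω, fderiv ℝ f x a ≤ (‖a‖ + η) * ∫ x, f x ∂(surfaceMeasure Ω) := by
  have := h.isFiniteMeasure
  have hcomp : ∀ {f : E N → ℝ} {ρ : ℝ}, tsupport f ⊆ Metric.ball p ρ → HasCompactSupport f :=
    fun hf => Metric.isCompact_of_isClosed_isBounded (isClosed_tsupport _)
      (Metric.isBounded_ball.subset hf)
  by_cases hpΩ : p ∈ Ω
  · obtain ⟨ρ, hρ, hball⟩ := Metric.isOpen_iff.1 h.isOpen p hpΩ
    refine ⟨ρ, hρ, fun f hf hf0 hfs => ?_⟩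
    have h0 : ∫ x in Ω, fderiv ℝ f x a = 0 := by
      rw [setIntegral_eq_integral_of_forall_compl_eq_zero, integral_fderiv_apply_eq_zero hf
        (hcomp hfs)]
      intro x hx
      have : x ∉ tsupport f := fun hxs => hx (hball (hfs hxs))
      rw [image_eq_zero_of_notMem_tsupport fun hxs => this (tsupport_fderiv_subset ℝ hxs)]
      rfl
    rw [h0]
    exact mul_nonneg (by positivity) (integral_nonneg hf0)
  have hpf : p ∈ frontier Ω := by
    rw [h.isOpen.frontier_eq]; exact ⟨hp, hpΩ⟩
  obtain ⟨e, ψ, he, hψ, hψe, ε, hε, hx⟩ := h.hasC1Boundary.exists_chart hpf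
  -- either `a + η e` and `e` are directions of monotonicity, and `∫ ∂ₑ f ≥ 0` can be discarded,
  -- or `-a` is one, and the flux is nonpositive
  by_cases ha : 0 ≤ fderiv ℝ ψ p a
  · have hb : 0 < fderiv ℝ ψ p (a + η • e) := by
      rw [map_add, map_smul, hψe, smul_eq_mul, mul_one]; linarith
    obtain ⟨ρ₁, hρ₁, h₁⟩ := exists_ball_monotone hψ hb hε hx
    obtain ⟨ρ₂, hρ₂, h₂⟩ := exists_ball_monotone hψ (b := e) (by rw [hψe]; exact one_pos) hε hx
    refine ⟨min ρ₁ ρ₂, lt_min hρ₁ hρ₂, fun f hf hf0 hfs => ?_⟩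
    have hb0 : a + η • e ≠ 0 := fun h0 => by rw [h0, map_zero] at hb; exact lt_irrefl _ hb
    have he0 : e ≠ 0 := fun h0 => by simp [h0] at he
    have f1 := (monotone_flux_smul hb0 h.isOpen Metric.isOpen_ball (convex_ball p _)
      (h₁ _ (min_le_left _ _)) hf (hcomp hfs) hfs hf0).2
    have f2 := (monotone_flux_smul he0 h.isOpen Metric.isOpen_ball (convex_ball p _)
      (h₂ _ (min_le_right _ _)) hf (hcomp hfs) hfs hf0).1
    have hsplit : ∫ x in Ω, fderiv ℝ f x (a + η • e) =
        (∫ x in Ω, fderiv ℝ f x a) + η * ∫ x in Ω, fderiv ℝ f x e := by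
      rw [← integral_const_mul, ← integral_add]
      · simp
      · exact (integrable_fderiv_apply hf (hcomp hfs) a).integrableOn
      · exact ((integrable_fderiv_apply hf (hcomp hfs) e).const_mul _).integrableOn
    have hnorm : ‖a + η • e‖ ≤ ‖a‖ + η := by
      refine (norm_add_le _ _).trans ?_
      rw [norm_smul, he, mul_one, Real.norm_of_nonneg hη.le]
    have hI : 0 ≤ ∫ x, f x ∂(surfaceMeasure Ω) := integral_nonneg hf0
    nlinarith [mul_nonneg hη.le f2, mul_le_mul_of_nonneg_right hnorm hI]
  · have hb : 0 < fderiv ℝ ψ p (-a) := by rw [map_neg]; linarith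
    obtain ⟨ρ₁, hρ₁, h₁⟩ := exists_ball_monotone hψ hb hε hx
    refine ⟨ρ₁, hρ₁, fun f hf hf0 hfs => ?_⟩
    have hb0 : -a ≠ 0 := fun h0 => by rw [h0, map_zero] at hb; exact lt_irrefl _ hb
    have f1 := (monotone_flux_smul hb0 h.isOpen Metric.isOpen_ball (convex_ball p _)
      (h₁ _ le_rfl) hf (hcomp hfs) hfs hf0).1
    simp only [map_neg, integral_neg] at f1
    exact le_trans (by linarith) (mul_nonneg (by positivity) (integral_nonneg hf0))

/-! ### The flux inequality on `C^1` domains -/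

/-- The divergence of the vector field with components `F i`. -/
def divergence {N : ℕ} (F : Fin N → E N → ℝ) (x : E N) : ℝ :=
  ∑ i, fderiv ℝ (F i) x (stdVec i)

theorem continuous_divergence {N : ℕ} {F : Fin N → E N → ℝ} (hF : ∀ i, ContDiff ℝ 1 (F i)) :
    Continuous (divergence F) :=
  continuous_finsetSum _ fun i _ =>
    ((hF i).continuous_fderiv one_ne_zero).clm_apply continuous_const

theorem IsBoundedC1Domain.isCompact_frontier {N : ℕ} {Ω : Set (E N)} (h : IsBoundedC1Domain Ω) :
    IsCompact (frontier Ω) :=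
  Metric.isCompact_of_isClosed_isBounded isClosed_frontier
    (h.isBounded.closure.subset frontier_subset_closure)

theorem IsBoundedC1Domain.memLp_surface {N : ℕ} {Ω : Set (E N)} (h : IsBoundedC1Domain Ω)
    {f : E N → ℝ} (hf : Continuous f) (q : ℝ≥0∞) : MemLp f q (surfaceMeasure Ω) := by
  have := h.isFiniteMeasure
  obtain ⟨C, hC⟩ := h.isCompact_frontier.exists_bound_of_continuousOn hf.continuousOn
  refine MemLp.of_bound hf.aestronglyMeasurable C ?_
  exact (ae_restrict_iff' isClosed_frontier.measurableSet).2 (Eventually.of_forall hC)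

theorem IsBoundedC1Domain.integrable_surface {N : ℕ} {Ω : Set (E N)} (h : IsBoundedC1Domain Ω)
    {f : E N → ℝ} (hf : Continuous f) : Integrable f (surfaceMeasure Ω) :=
  memLp_one_iff_integrable.1 (h.memLp_surface hf 1)

theorem memLp_of_isBounded {N : ℕ} {Ω : Set (E N)} (hb : Bornology.IsBounded Ω)
    {f : E N → ℝ} (hf : Continuous f) (q : ℝ≥0∞) : MemLp f q (volume.restrict Ω) := by
  have hc : IsCompact (closure Ω) :=
    Metric.isCompact_of_isClosed_isBounded isClosed_closure hb.closure
  obtain ⟨C, hC⟩ := hc.exists_bound_of_continuousOn hf.continuousOn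
  have : IsFiniteMeasure (volume.restrict (closure Ω)) := ⟨by
    rw [Measure.restrict_apply_univ]; exact hc.measure_lt_top⟩
  have h1 : MemLp f q (volume.restrict (closure Ω)) :=
    MemLp.of_bound hf.aestronglyMeasurable C
      ((ae_restrict_iff' isClosed_closure.measurableSet).2 (Eventually.of_forall hC))
  exact h1.mono_measure (Measure.restrict_mono subset_closure le_rfl)

theorem integrableOn_of_isBounded {N : ℕ} {Ω : Set (E N)} (hb : Bornology.IsBounded Ω)
    {f : E N → ℝ} (hf : Continuous f) : IntegrableOn f Ω :=
  memLp_one_iff_integrable.1 (memLp_of_isBounded hb hf 1)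

theorem eventually_nhdsGT_of_exists {P : ℝ → Prop} (h : ∃ ρ > 0, ∀ ρ' ≤ ρ, P ρ') :
    ∀ᶠ ρ in 𝓝[>] (0 : ℝ), P ρ := by
  obtain ⟨ρ, hρ, hP⟩ := h
  filter_upwards [Ioc_mem_nhdsGT hρ] with ρ' hρ' using hP ρ' hρ'.2

/-- The flux inequality for `φ F` with `φ ≥ 0` concentrated near `p`, obtained from the case of
constant vectors by freezing `F` at `p`. -/
theorem exists_local_divergence_le {N : ℕ} {Ω : Set (E N)} (h : IsBoundedC1Domain Ω) {p : E N}
    (hp : p ∈ closure Ω) {F : Fin N → E N → ℝ} (hF : ∀ i, ContDiff ℝ 1 (F i)) {η : ℝ}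
    (hη : 0 < η) :
    ∃ ρ > 0, ∀ φ : E N → ℝ, ContDiff ℝ 1 φ → (∀ x, 0 ≤ φ x) → tsupport φ ⊆ Metric.ball p ρ →
      ∫ x in Ω, divergence (fun i x => φ x * F i x) x ≤
        ∫ x, φ x * (√(∑ i, (F i x) ^ 2) + η) ∂(surfaceMeasure Ω) := by
  obtain ⟨δ, hδ0, hδ1, hδη⟩ : ∃ δ : ℝ, 0 < δ ∧ δ ≤ 1 ∧ (6 * N + 2) * δ ≤ η := by
    refine ⟨min 1 (η / (6 * N + 2)), by positivity, min_le_left _ _, ?_⟩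
    calc (6 * (N : ℝ) + 2) * min 1 (η / (6 * N + 2)) ≤ (6 * N + 2) * (η / (6 * N + 2)) := by
          gcongr; exact min_le_right _ _
      _ = η := by field_simp
  set a : E N := WithLp.toLp 2 (fun i => F i p) with ha
  have hnorma : ‖a‖ = √(∑ i, (F i p) ^ 2) := by
    rw [EuclideanSpace.norm_eq]; simp [ha]
  have hev : ∀ b : E N, ∀ᶠ ρ in 𝓝[>] (0 : ℝ), ∀ f : E N → ℝ, ContDiff ℝ 1 f → (∀ x, 0 ≤ f x) →
      tsupport f ⊆ Metric.ball p ρ →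
      ∫ x in Ω, fderiv ℝ f x b ≤ (‖b‖ + δ) * ∫ x, f x ∂(surfaceMeasure Ω) := by
    intro b
    obtain ⟨ρ, hρ, hP⟩ := exists_local_flux_le h hp b hδ0
    exact eventually_nhdsGT_of_exists ⟨ρ, hρ, fun ρ' hρ' f h1 h2 h3 =>
      hP f h1 h2 (h3.trans (Metric.ball_subset_ball hρ'))⟩
  have hcev : ∀ G : E N → ℝ, Continuous G → ∀ᶠ ρ in 𝓝[>] (0 : ℝ),
      ∀ x ∈ Metric.ball p ρ, |G x - G p| ≤ δ := by
    intro G hG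
    obtain ⟨ρ, hρ, hP⟩ := Metric.continuous_iff.1 hG p δ hδ0
    exact eventually_nhdsGT_of_exists ⟨ρ, hρ, fun ρ' hρ' x hx =>
      (hP x ((Metric.ball_subset_ball hρ') hx)).le⟩
  have hFc : ∀ i, Continuous (F i) := fun i => (hF i).continuous
  have hnc : Continuous fun x => √(∑ i, (F i x) ^ 2) := by fun_prop
  have hpos : ∀ᶠ ρ in 𝓝[>] (0 : ℝ), 0 < ρ := self_mem_nhdsWithin
  obtain ⟨ρ, hρ, h1, h2, h3, h4, h5⟩ := (hpos.and ((hev a).and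
    ((eventually_all.2 fun i => hev (stdVec i)).and
    ((eventually_all.2 fun i => hev (-stdVec i)).and
    ((eventually_all.2 fun i => hcev (F i) (hFc i)).and (hcev _ hnc)))))).exists
  refine ⟨ρ, hρ, fun φ hφ hφ0 hφs => ?_⟩
  have hφc : HasCompactSupport φ := Metric.isCompact_of_isClosed_isBounded (isClosed_tsupport _)
      (Metric.isBounded_ball.subset hφs)
  have hφout : ∀ x, x ∉ Metric.ball p ρ → φ x = 0 := fun x hx =>
    image_eq_zero_of_notMem_tsupport fun hxs => hx (hφs hxs)
  set I := ∫ x, φ x ∂(surfaceMeasure Ω) with hI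
  have hI0 : 0 ≤ I := integral_nonneg hφ0
  have hφI : Integrable φ (surfaceMeasure Ω) := h.integrable_surface hφ.continuous
  -- each component is made nonnegative near `p` by adding the small constant `δ`
  set g : Fin N → E N → ℝ := fun i x => φ x * (F i x - F i p + δ) with hg
  have hgC : ∀ i, ContDiff ℝ 1 (g i) := fun i =>
    hφ.mul (((hF i).sub contDiff_const).add contDiff_const)
  have hgs : ∀ i, tsupport (g i) ⊆ Metric.ball p ρ := fun i =>
    (closure_mono (Function.support_mul_subset_left φ _)).trans hφs
  have hgc : ∀ i, HasCompactSupport (g i) := fun i => hφc.mul_right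
  have hg0 : ∀ i x, 0 ≤ g i x := fun i x => by
    by_cases hx : x ∈ Metric.ball p ρ
    · exact mul_nonneg (hφ0 x) (by linarith [(abs_le.1 (h4 i x hx)).1])
    · simp [hg, hφout x hx]
  have hgI : ∀ i, ∫ x, g i x ∂(surfaceMeasure Ω) ≤ 2 * δ * I := fun i => by
    rw [hI, ← integral_const_mul]
    refine integral_mono (h.integrable_surface (hgC i).continuous) (hφI.const_mul _) fun x => ?_
    by_cases hx : x ∈ Metric.ball p ρ
    · simp only [hg]
      rw [mul_comm]
      exact mul_le_mul_of_nonneg_right (by linarith [(abs_le.1 (h4 i x hx)).2]) (hφ0 x)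
    · simp [hg, hφout x hx]
  have hstd : ∀ i : Fin N, ‖(stdVec i : E N)‖ = 1 := fun i => by simp [stdVec]
  have b1 : ∫ x in Ω, fderiv ℝ φ x a ≤ (‖a‖ + δ) * I := h1 φ hφ hφ0 hφs
  have b2 : ∀ i, ∫ x in Ω, fderiv ℝ (g i) x (stdVec i) ≤ 4 * δ * I := fun i => by
    refine (h2 i (g i) (hgC i) (hg0 i) (hgs i)).trans ?_
    rw [hstd]
    have h0 : 0 ≤ ∫ x, g i x ∂(surfaceMeasure Ω) := integral_nonneg (hg0 i)
    nlinarith [hgI i]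
  have b3 : ∀ i : Fin N, ∫ x in Ω, fderiv ℝ φ x (-stdVec i) ≤ 2 * I := fun i => by
    refine (h3 i φ hφ hφ0 hφs).trans ?_
    rw [norm_neg, hstd]
    nlinarith
  have hpt : ∀ x, divergence (fun i x => φ x * F i x) x = (∑ i, fderiv ℝ (g i) x (stdVec i)) +
      fderiv ℝ φ x a + ∑ i : Fin N, δ * fderiv ℝ φ x (-stdVec i) := by
    intro x
    have ha' : a = ∑ i, F i p • (stdVec i : E N) := by
      ext j
      simp [ha, stdVec, Pi.single_apply]
    have hgd : ∀ i, fderiv ℝ (g i) x (stdVec i) = fderiv ℝ (fun x => φ x * F i x) x (stdVec i)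
        - (F i p - δ) * fderiv ℝ φ x (stdVec i) := fun i => by
      have e1 : g i = fun x => φ x * F i x - (F i p - δ) * φ x := by
        ext x; simp only [hg]; ring
      have hd1 : DifferentiableAt ℝ (fun x => φ x * F i x) x :=
        ((hφ.mul (hF i)).differentiable one_ne_zero) x
      have hd2 : DifferentiableAt ℝ φ x := (hφ.differentiable one_ne_zero) x
      rw [e1, fderiv_fun_sub hd1 (hd2.const_mul _), fderiv_const_mul hd2]
      simp
    rw [ha', map_sum, divergence, ← Finset.sum_add_distrib, ← Finset.sum_add_distrib]
    refine Finset.sum_congr rfl fun i _ => ?_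
    rw [hgd, map_smul, map_neg, smul_eq_mul]
    ring
  have hint : ∫ x in Ω, divergence (fun i x => φ x * F i x) x =
      (∑ i, ∫ x in Ω, fderiv ℝ (g i) x (stdVec i)) + (∫ x in Ω, fderiv ℝ φ x a) +
        ∑ i : Fin N, δ * ∫ x in Ω, fderiv ℝ φ x (-stdVec i) := by
    simp only [hpt]
    have i1 : ∀ i : Fin N, IntegrableOn (fun x => fderiv ℝ (g i) x (stdVec i)) Ω := fun i =>
      (integrable_fderiv_apply (hgC i) (hgc i) _).integrableOn
    have i2 : ∀ b, IntegrableOn (fun x => fderiv ℝ φ x b) Ω := fun b =>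
      (integrable_fderiv_apply hφ hφc b).integrableOn
    rw [integral_add, integral_add, integral_finsetSum, integral_finsetSum]
    · simp only [integral_const_mul]
    · exact fun i _ => (i2 _).const_mul _
    · exact fun i _ => i1 i
    · exact integrable_finsetSum _ fun i _ => i1 i
    · exact i2 a
    · exact (integrable_finsetSum _ fun i _ => i1 i).add (i2 a)
    · exact integrable_finsetSum _ fun i _ => (i2 _).const_mul _
  have s1 : ∑ i, ∫ x in Ω, fderiv ℝ (g i) x (stdVec i) ≤ N * (4 * δ * I) := by
    simpa using Finset.sum_le_sum fun i (_ : i ∈ Finset.univ) => b2 i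
  have s2 : ∑ i : Fin N, δ * ∫ x in Ω, fderiv ℝ φ x (-stdVec i) ≤ N * (δ * (2 * I)) := by
    simpa using Finset.sum_le_sum fun i (_ : i ∈ Finset.univ) =>
      mul_le_mul_of_nonneg_left (b3 i) hδ0.le
  have hfin : (‖a‖ - δ + η) * I ≤ ∫ x, φ x * (√(∑ i, (F i x) ^ 2) + η) ∂(surfaceMeasure Ω) := by
    rw [hI, ← integral_const_mul]
    refine integral_mono (hφI.const_mul _)
      (h.integrable_surface (hφ.continuous.mul (hnc.add continuous_const))) fun x => ?_
    by_cases hx : x ∈ Metric.ball p ρ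
    · simp only
      rw [mul_comm]
      refine mul_le_mul_of_nonneg_left ?_ (hφ0 x)
      have := (abs_le.1 (h5 x hx)).1
      rw [hnorma]
      linarith
    · simp [hφout x hx]
  rw [hint]
  nlinarith [mul_le_mul_of_nonneg_right hδη hI0]

open scoped Manifold in
/-- The outward flux of a `C^1` vector field through the boundary is at most the integral of its
length; the flux is expressed through the divergence theorem as a volume integral. -/
theorem integral_divergence_le {N : ℕ} {Ω : Set (E N)} (h : IsBoundedC1Domain Ω)
    {F : Fin N → E N → ℝ} (hF : ∀ i, ContDiff ℝ 1 (F i)) :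
    ∫ x in Ω, divergence F x ≤ ∫ x, √(∑ i, (F i x) ^ 2) ∂(surfaceMeasure Ω) := by
  have := h.isFiniteMeasure
  have hFc : ∀ i, Continuous (F i) := fun i => (hF i).continuous
  have hnc : Continuous fun x => √(∑ i, (F i x) ^ 2) := by fun_prop
  suffices hη : ∀ η > 0, ∫ x in Ω, divergence F x ≤
      (∫ x, √(∑ i, (F i x) ^ 2) ∂(surfaceMeasure Ω)) + η * (surfaceMeasure Ω).real Set.univ by
    refine le_of_forall_pos_le_add fun ε hε => (hη (ε / ((surfaceMeasure Ω).real Set.univ + 1))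
      (by positivity)).trans ?_
    gcongr
    rw [div_mul_eq_mul_div, div_le_iff₀ (by positivity)]
    nlinarith
  intro η hη
  choose! ρ hρ hloc using fun p (hp : p ∈ closure Ω) => exists_local_divergence_le h hp hF hη
  have hcpt : IsCompact (closure Ω) :=
    Metric.isCompact_of_isClosed_isBounded isClosed_closure h.isBounded.closure
  obtain ⟨t, ht, htc⟩ := hcpt.elim_nhds_subcover (fun p => Metric.ball p (ρ p))
    fun p hp => Metric.ball_mem_nhds p (hρ p hp)
  obtain ⟨φ, hφ⟩ := SmoothPartitionOfUnity.exists_isSubordinate 𝓘(ℝ, E N)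
    (isClosed_closure (s := Ω)) (fun p : t => Metric.ball (p : E N) (ρ p))
    (fun _ => Metric.isOpen_ball) (htc.trans (by
      intro x hx
      simp only [Set.mem_iUnion] at hx ⊢
      obtain ⟨p, hp, hx⟩ := hx
      exact ⟨⟨p, hp⟩, hx⟩))
  have hφC : ∀ k, ContDiff ℝ 1 (φ k) := fun k => (φ k).contMDiff.contDiff.of_le (by norm_cast)
  have hφ1 : ∀ x ∈ closure Ω, ∑ k, φ k x = 1 := fun x hx => by
    rw [← finsum_eq_sum_of_fintype]; exact φ.sum_eq_one hx
  have hdiv : ∀ x ∈ Ω, divergence F x = ∑ k, divergence (fun i x => φ k x * F i x) x := by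
    intro x hx
    simp only [divergence]
    rw [Finset.sum_comm]
    refine Finset.sum_congr rfl fun i _ => ?_
    have heq : F i =ᶠ[𝓝 x] fun y => ∑ k, φ k y * F i y := by
      filter_upwards [h.isOpen.mem_nhds hx] with y hy
      rw [← Finset.sum_mul, hφ1 y (subset_closure hy), one_mul]
    rw [heq.fderiv_eq, fderiv_fun_sum fun k _ =>
      ((hφC k).mul (hF i)).differentiable one_ne_zero x]
    simp
  rw [setIntegral_congr_fun h.isOpen.measurableSet hdiv, integral_finsetSum _ fun k _ =>
    integrableOn_of_isBounded h.isBounded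
      (continuous_divergence fun i => (hφC k).mul (hF i))]
  calc _ ≤ ∑ k, ∫ x, φ k x * (√(∑ i, (F i x) ^ 2) + η) ∂(surfaceMeasure Ω) :=
        Finset.sum_le_sum fun k _ => hloc k (ht k k.2) (φ k) (hφC k) (fun x => φ.nonneg k x) (hφ k)
    _ = ∫ x, (√(∑ i, (F i x) ^ 2) + η) ∂(surfaceMeasure Ω) := by
        have hi : ∀ k ∈ Finset.univ, Integrable (fun x => φ k x * (√(∑ i, (F i x) ^ 2) + η))
            (surfaceMeasure Ω) := fun k _ => h.integrable_surface
          ((hφC k).continuous.mul (hnc.add continuous_const))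
        rw [← integral_finsetSum _ hi]
        refine setIntegral_congr_fun isClosed_frontier.measurableSet fun x hx => ?_
        rw [← Finset.sum_mul, hφ1 x (frontier_subset_closure hx), one_mul]
    _ = _ := by
        rw [integral_add (h.integrable_surface hnc) (integrable_const _), integral_const,
          smul_eq_mul, mul_comm η]

/-! ### The area of the sphere -/

/-- Radial projection onto the unit ball does not increase distances outside the ball. -/
theorem norm_normalize_sub_normalize_le {N : ℕ} {x y : E N} (hx : 1 ≤ ‖x‖) (hy : 1 ≤ ‖y‖) :
    ‖‖x‖⁻¹ • x - ‖y‖⁻¹ • y‖ ≤ ‖x - y‖ := by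
  set u := ‖x‖⁻¹ • x with hu
  set v := ‖y‖⁻¹ • y with hv
  have hx0 : ‖x‖ ≠ 0 := by positivity
  have hy0 : ‖y‖ ≠ 0 := by positivity
  have hu1 : ‖u‖ = 1 := by rw [hu, norm_smul, norm_inv, norm_norm, inv_mul_cancel₀ hx0]
  have hv1 : ‖v‖ = 1 := by rw [hv, norm_smul, norm_inv, norm_norm, inv_mul_cancel₀ hy0]
  have hxu : x = ‖x‖ • u := by rw [hu, smul_smul, mul_inv_cancel₀ hx0, one_smul]
  have hyv : y = ‖y‖ • v := by rw [hv, smul_smul, mul_inv_cancel₀ hy0, one_smul]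
  have h1 : ‖x - y‖ ^ 2 = ‖x‖ ^ 2 - 2 * (‖x‖ * ‖y‖ * inner ℝ u v) + ‖y‖ ^ 2 := by
    rw [norm_sub_sq_real]
    have : (inner ℝ x y : ℝ) = ‖x‖ * ‖y‖ * inner ℝ u v := by
      conv_lhs => rw [hxu, hyv, real_inner_smul_left, real_inner_smul_right]
      ring
    rw [this]
  have h2 : ‖u - v‖ ^ 2 = 2 - 2 * inner ℝ u v := by
    rw [norm_sub_sq_real, hu1, hv1]; ring
  have h3 : (inner ℝ u v : ℝ) ≤ 1 := by
    simpa [hu1, hv1] using real_inner_le_norm u v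
  refine (sq_le_sq₀ (norm_nonneg _) (norm_nonneg _)).1 ?_
  rw [h1, h2]
  nlinarith [sq_nonneg (‖x‖ - ‖y‖), mul_le_mul hx hy zero_le_one (norm_nonneg x)]

/-- The open cone with vertex `0`, of height `1`, over a subset `A` of the unit sphere. -/
def cone {N : ℕ} (A : Set (E N)) : Set (E N) := {x | ‖x‖ < 1 ∧ ‖x‖⁻¹ • x ∈ A}

theorem measurable_normalize {N : ℕ} : Measurable fun x : E N => ‖x‖⁻¹ • x :=
  measurable_norm.inv.smul measurable_id

theorem measurableSet_cone {N : ℕ} {A : Set (E N)} (hA : MeasurableSet A) :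
    MeasurableSet (cone A) :=
  (measurableSet_lt measurable_norm measurable_const).inter (measurable_normalize hA)

/-- The central projection of the affine hyperplane `p + pᗮ` onto the unit sphere. -/
def gnomonic {N : ℕ} (p : E N) (z : (ℝ ∙ p)ᗮ) : E N := ‖p + (z : E N)‖⁻¹ • (p + (z : E N))

theorem inner_add_orthogonal {N : ℕ} {p : E N} (hp : ‖p‖ = 1) (z : (ℝ ∙ p)ᗮ) :
    inner ℝ p (p + (z : E N)) = 1 := by
  have hz : inner ℝ p (z : E N) = 0 :=
    Submodule.mem_orthogonal_singleton_iff_inner_right.1 z.2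
  rw [inner_add_right, hz, real_inner_self_eq_norm_sq, hp]; norm_num

theorem one_le_norm_add_orthogonal {N : ℕ} {p : E N} (hp : ‖p‖ = 1) (z : (ℝ ∙ p)ᗮ) :
    1 ≤ ‖p + (z : E N)‖ := by
  have := real_inner_le_norm p (p + (z : E N))
  rwa [inner_add_orthogonal hp, hp, one_mul] at this

theorem lipschitzWith_gnomonic {N : ℕ} {p : E N} (hp : ‖p‖ = 1) :
    LipschitzWith 1 (gnomonic p) := by
  refine LipschitzWith.of_dist_le_mul fun z w => ?_
  rw [dist_eq_norm, NNReal.coe_one, one_mul, dist_eq_norm]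
  refine (norm_normalize_sub_normalize_le (one_le_norm_add_orthogonal hp z)
    (one_le_norm_add_orthogonal hp w)).trans_eq ?_
  rw [add_sub_add_left_eq_sub, ← Submodule.coe_sub, Submodule.coe_norm]

theorem lintegral_Ioo_pow (m : ℕ) {κ : ℝ} (hκ : 0 < κ) :
    ∫⁻ s in Set.Ioo 0 κ, ENNReal.ofReal (s ^ m) = ENNReal.ofReal (κ ^ (m + 1) / (m + 1)) := by
  have hint : IntegrableOn (fun s : ℝ => s ^ m) (Set.Ioo 0 κ) :=
    ((continuous_pow m).integrableOn_Icc).mono_set Set.Ioo_subset_Icc_self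
  rw [← ofReal_integral_eq_lintegral_ofReal hint]
  · rw [← integral_Ioc_eq_integral_Ioo, ← intervalIntegral.integral_of_le hκ.le, integral_pow]
    simp
  · filter_upwards [ae_restrict_mem measurableSet_Ioo] with s hs using pow_nonneg hs.1.le m

/-- In a spherical cap about `p`, surface measure exceeds cone measure by at most the factor
`κ⁻ᴺ`, where `κ` is the cosine of the opening angle: both are compared with the measure of the
central projection of `A` to the hyperplane tangent at `p`. -/
theorem euclideanHausdorffMeasure_le_volume_cone_of_cap {N : ℕ} {p : E N} (hp : ‖p‖ = 1)
    {κ : ℝ} (hκ : 0 < κ) {A : Set (E N)} (hA : MeasurableSet A)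
    (hAs : ∀ x ∈ A, ‖x‖ = 1 ∧ κ < inner ℝ p x) :
    ENNReal.ofReal (κ ^ N) * μHE[N - 1] A ≤ N * volume (cone A) := by
  set A' := gnomonic p ⁻¹' A with hA'
  have hA'm : MeasurableSet A' := (lipschitzWith_gnomonic hp).continuous.measurable hA
  have hN : N - 1 + 1 = N := by
    have : N ≠ 0 := by
      rintro rfl
      rw [Subsingleton.elim p 0] at hp
      simp at hp
    omega
  have h1 : μHE[N - 1] A ≤ volume A' := by
    rw [volume_orthogonal_eq hp]
    refine le_trans (measure_mono (t := gnomonic p '' A') ?_) (by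
      simpa using euclideanHausdorffMeasure_image_le
        ((lipschitzWith_gnomonic hp).lipschitzOnWith (s := A')) (N - 1))
    intro x hx
    obtain ⟨hx1, hx2⟩ := hAs x hx
    have hc : 0 < (inner ℝ p x : ℝ) := hκ.trans hx2
    have hz : (inner ℝ p x : ℝ)⁻¹ • x - p ∈ (ℝ ∙ p)ᗮ := by
      rw [Submodule.mem_orthogonal_singleton_iff_inner_right, inner_sub_right,
        real_inner_smul_right, inv_mul_cancel₀ hc.ne', real_inner_self_eq_norm_sq, hp]
      norm_num
    have hg : gnomonic p ⟨_, hz⟩ = x := by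
      simp only [gnomonic, add_sub_cancel]
      rw [norm_smul, hx1, mul_one, Real.norm_of_nonneg (inv_pos.2 hc).le, inv_inv, smul_smul,
        mul_inv_cancel₀ hc.ne', one_smul]
    exact ⟨⟨_, hz⟩, by rw [hA', Set.mem_preimage, hg]; exact hx, hg⟩
  -- the cone over the projection `A'`, cut at height `κ`, lies in the cone over `A`
  set D : Set (ℝ × (ℝ ∙ p)ᗮ) := {q | q.1 ∈ Set.Ioo 0 κ ∧ q.1⁻¹ • q.2 ∈ A'} with hD
  have hDm : MeasurableSet D := by
    have hm : Measurable fun q : ℝ × (ℝ ∙ p)ᗮ => q.1⁻¹ • q.2 :=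
      measurable_fst.inv.smul measurable_snd
    exact (measurable_fst measurableSet_Ioo).inter (hm hA'm)
  have h2 : volume D ≤ volume (cone A) := by
    rw [← (measurePreserving_sliceMap hp).measure_preimage
      (measurableSet_cone hA).nullMeasurableSet]
    refine measure_mono ?_
    rintro ⟨s, y⟩ ⟨hs, hy⟩
    set z := s⁻¹ • y with hz
    have hs0 : 0 < s := hs.1
    have hsl : sliceMap p (s, y) = s • (p + (z : E N)) := by
      simp only [sliceMap, hz, Submodule.coe_smul, smul_add, smul_smul]
      rw [mul_inv_cancel₀ hs0.ne', one_smul]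
    have hn := one_le_norm_add_orthogonal hp z
    have hκz : κ < ‖p + (z : E N)‖⁻¹ := by
      have := (hAs _ hy).2
      rwa [gnomonic, real_inner_smul_right, inner_add_orthogonal hp, mul_one] at this
    have hlt : κ * ‖p + (z : E N)‖ < 1 := by
      rwa [lt_inv_comm₀ hκ (by linarith), ← one_div, lt_div_iff₀ hκ, mul_comm] at hκz
    rw [Set.mem_preimage, hsl]
    refine ⟨?_, ?_⟩
    · rw [norm_smul, Real.norm_of_nonneg hs0.le]
      have := hs.2
      nlinarith
    · rw [norm_smul, Real.norm_of_nonneg hs0.le, smul_smul, mul_inv, mul_comm s⁻¹, mul_assoc,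
        inv_mul_cancel₀ hs0.ne', mul_one]
      exact hy
  have h3 : volume D = ENNReal.ofReal (κ ^ N / N) * volume A' := by
    have hN' : ((N - 1 : ℕ) : ℝ) + 1 = N := by exact_mod_cast hN
    have hfib : ∀ s : ℝ, volume (Prod.mk s ⁻¹' D) =
        (Set.Ioo 0 κ).indicator (fun s => ENNReal.ofReal (s ^ (N - 1)) * volume A') s := by
      intro s
      by_cases hs : s ∈ Set.Ioo 0 κ
      · rw [Set.indicator_of_mem hs]
        have : Prod.mk s ⁻¹' D = (fun y : (ℝ ∙ p)ᗮ => s⁻¹ • y) ⁻¹' A' := by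
          ext y; simp [hD, hs.1, hs.2]
        rw [this, Measure.addHaar_preimage_smul _ (inv_ne_zero hs.1.ne'),
          finrank_orthogonal_span hp, inv_pow, inv_inv, abs_of_nonneg (pow_nonneg hs.1.le _)]
      · rw [Set.indicator_of_notMem hs]
        have : Prod.mk s ⁻¹' D = ∅ := by
          ext y
          simp only [hD, Set.mem_preimage, Set.mem_ofPred_eq, Set.mem_empty_iff_false, iff_false]
          exact fun h => hs h.1
        rw [this, measure_empty]
    rw [Measure.volume_eq_prod, Measure.prod_apply hDm]
    simp only [hfib]
    rw [lintegral_indicator measurableSet_Ioo, lintegral_mul_const _ (by fun_prop),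
      lintegral_Ioo_pow _ hκ, hN, hN']
  have hN0 : (0 : ℝ) < N := by
    have : 0 < N := by omega
    exact_mod_cast this
  calc ENNReal.ofReal (κ ^ N) * μHE[N - 1] A ≤ ENNReal.ofReal (N * (κ ^ N / N)) * volume A' := by
        rw [mul_div_cancel₀ _ hN0.ne']; gcongr
    _ = N * volume D := by
        rw [h3, ENNReal.ofReal_mul hN0.le, ENNReal.ofReal_natCast, mul_assoc]
    _ ≤ N * volume (cone A) := by gcongr

/-- Finitely many caps are glued along a measurable partition; the cones over its parts are
disjoint. -/
theorem euclideanHausdorffMeasure_le_volume_cone_of_cover {N : ℕ} {κ : ℝ} (hκ : 0 < κ)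
    (t : Finset (E N)) (ht : ∀ p ∈ t, ‖p‖ = 1) : ∀ A : Set (E N), MeasurableSet A →
      (∀ x ∈ A, ‖x‖ = 1 ∧ ∃ p ∈ t, κ < inner ℝ p x) →
      ENNReal.ofReal (κ ^ N) * μHE[N - 1] A ≤ N * volume (cone A) := by
  classical
  induction t using Finset.induction_on with
  | empty =>
    intro A _ h
    have : A = ∅ := Set.eq_empty_of_forall_notMem fun x hx => by simpa using (h x hx).2
    simp [this]
  | insert p t _ ih =>
    intro A hA h
    set U : Set (E N) := {x | κ < inner ℝ p x} with hU
    have hUm : MeasurableSet U :=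
      (isOpen_lt continuous_const (continuous_const.inner continuous_id)).measurableSet
    have h1 := euclideanHausdorffMeasure_le_volume_cone_of_cap
      (ht p (Finset.mem_insert_self p t)) hκ (hA.inter hUm) fun x hx => ⟨(h x hx.1).1, hx.2⟩
    have h2 := ih (fun q hq => ht q (Finset.mem_insert_of_mem hq)) (A \ U)
      (hA.diff hUm) fun x hx => by
      obtain ⟨hx1, q, hq, hqx⟩ := h x hx.1
      refine ⟨hx1, q, ?_, hqx⟩
      rcases Finset.mem_insert.1 hq with rfl | hq
      · exact absurd hqx hx.2
      · exact hq
    have h3 : volume (cone A) = volume (cone (A ∩ U)) + volume (cone (A \ U)) := by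
      rw [← measure_inter_add_sdiff (cone A) (measurable_normalize hUm)]
      congr 2 <;> ext x <;> simp [cone, and_assoc]
    rw [← measure_inter_add_sdiff A hUm, h3, mul_add, mul_add]
    exact add_le_add h1 h2

/-- The surface area of the unit sphere is at most `N` times the volume of the unit ball. -/
theorem euclideanHausdorffMeasure_unitSphere_le (N : ℕ) :
    μHE[N - 1] (Metric.sphere (0 : E N) 1) ≤ N * volume (Metric.ball (0 : E N) 1) := by
  have key : ∀ κ ∈ Set.Ioo (0 : ℝ) 1,
      ENNReal.ofReal (κ ^ N) * μHE[N - 1] (Metric.sphere (0 : E N) 1) ≤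
        N * volume (Metric.ball (0 : E N) 1) := by
    intro κ hκ
    obtain ⟨t, ht, htc⟩ := (isCompact_sphere (0 : E N) 1).elim_nhds_subcover
      (fun p => {x | κ < inner ℝ p x}) fun p hp => by
        refine (isOpen_lt continuous_const (continuous_const.inner continuous_id)).mem_nhds ?_
        have hp1 : ‖p‖ = 1 := by simpa using hp
        simpa [real_inner_self_eq_norm_sq, hp1] using hκ.2
    refine (euclideanHausdorffMeasure_le_volume_cone_of_cover hκ.1 t
      (fun p hp => by simpa using ht p hp) _ Metric.isClosed_sphere.measurableSet
      fun x hx => ?_).trans ?_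
    · refine ⟨by simpa using hx, ?_⟩
      simpa using htc hx
    · gcongr
      intro x hx
      simpa using hx.1
  have hlim : Tendsto (fun κ : ℝ => ENNReal.ofReal (κ ^ N) *
      μHE[N - 1] (Metric.sphere (0 : E N) 1)) (𝓝[<] 1)
      (𝓝 (ENNReal.ofReal (1 ^ N) * μHE[N - 1] (Metric.sphere (0 : E N) 1))) := by
    refine ENNReal.Tendsto.mul_const ?_ (Or.inl (by simp))
    exact ((ENNReal.continuous_ofReal.comp (continuous_pow N)).tendsto 1).mono_left
      nhdsWithin_le_nhds
  simpa using le_of_tendsto hlim (by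
    filter_upwards [Ioo_mem_nhdsLT zero_lt_one] with κ hκ using key κ hκ)

open scoped Pointwise in
theorem surfaceMeasure_ball_le {N : ℕ} (hN : 1 ≤ N) (c : E N) {r : ℝ} (hr : 0 < r) :
    r * (surfaceMeasure (Metric.ball c r)).real Set.univ ≤ N * volume.real (Metric.ball c r) := by
  have hs : Metric.sphere c r = AffineMap.homothety c r '' Metric.sphere c 1 := by
    ext x
    constructor
    · intro hx
      refine ⟨AffineMap.homothety c r⁻¹ x, ?_, ?_⟩
      · rw [mem_sphere_iff_norm] at hx ⊢
        simp [AffineMap.homothety_apply, norm_smul, hx, abs_of_pos hr, hr.ne']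
      · simp [AffineMap.homothety_apply, smul_smul, hr.ne']
    · rintro ⟨y, hy, rfl⟩
      rw [mem_sphere_iff_norm] at hy ⊢
      simp [AffineMap.homothety_apply, norm_smul, hy, abs_of_pos hr]
  have ht : Metric.sphere c 1 = (IsometryEquiv.vaddConst c : E N → E N) '' Metric.sphere 0 1 := by
    ext x; simp [mem_sphere_iff_norm, sub_eq_add_neg]
  have hσ : surfaceMeasure (Metric.ball c r) Set.univ =
      ENNReal.ofReal (r ^ (N - 1)) * μHE[N - 1] (Metric.sphere (0 : E N) 1) := by
    rw [surfaceMeasure, Measure.restrict_apply_univ, frontier_ball c hr.ne', hs,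
      euclideanHausdorffMeasure_homothety_image _ _ hr.ne', ht,
      (IsometryEquiv.vaddConst c).isometry.euclideanHausdorffMeasure_image, ENNReal.smul_def,
      smul_eq_mul]
    congr 1
    rw [ENNReal.ofReal, Real.toNNReal_pow hr.le, Real.nnnorm_of_nonneg hr.le,
      Real.toNNReal_of_nonneg hr.le]
  have hv : volume (Metric.ball c r) =
      ENNReal.ofReal (r ^ N) * volume (Metric.ball (0 : E N) 1) := by
    rw [Measure.addHaar_ball_of_pos _ _ hr, finrank_euclideanSpace_fin]
  have hle := euclideanHausdorffMeasure_unitSphere_le N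
  have hfin : N * volume (Metric.ball (0 : E N) 1) ≠ ⊤ :=
    ENNReal.mul_ne_top (by simp) Metric.isBounded_ball.measure_lt_top.ne
  have hle' := ENNReal.toReal_mono hfin hle
  rw [ENNReal.toReal_mul, ENNReal.toReal_natCast] at hle'
  rw [Measure.real, hσ, Measure.real, hv, ENNReal.toReal_mul, ENNReal.toReal_mul,
    ENNReal.toReal_ofReal (by positivity), ENNReal.toReal_ofReal (by positivity)]
  have hpow : r ^ N = r * r ^ (N - 1) := by rw [← pow_succ', Nat.sub_add_cancel hN]
  rw [hpow]
  have : 0 ≤ r * r ^ (N - 1) := by positivity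
  nlinarith [mul_le_mul_of_nonneg_left hle' this]

/-! ### The divergence theorem on a ball -/

theorem hasC1Boundary_ball {N : ℕ} (c : E N) {r : ℝ} (hr : 0 < r) :
    HasC1Boundary (Metric.ball c r) := by
  intro p hp
  rw [frontier_ball c hr.ne', mem_sphere_iff_norm] at hp
  set e : E N := r⁻¹ • (p - c) with he
  have he1 : ‖e‖ = 1 := by
    rw [he, norm_smul, hp, norm_inv, Real.norm_of_nonneg hr.le, inv_mul_cancel₀ hr.ne']
  have hpe : p - c = r • e := by rw [he, smul_smul, mul_inv_cancel₀ hr.ne', one_smul]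
  set P := (ℝ ∙ e)ᗮ.orthogonalProjectionOnto with hP
  have hPe : P e = 0 := Submodule.orthogonalProjectionOnto_orthogonalComplement_singleton_eq_zero e
  -- the factor `χ` makes the graph of the upper hemisphere globally smooth
  let χ : ContDiffBump (0 : (ℝ ∙ e)ᗮ) := ⟨r / 2, 3 * r / 4, by positivity, by linarith⟩
  have hpos : ∀ z : (ℝ ∙ e)ᗮ, 0 < r ^ 2 - ‖z‖ ^ 2 * χ z := by
    intro z
    by_cases hz : ‖z‖ < 3 * r / 4
    · have h1 : ‖z‖ ^ 2 * χ z ≤ ‖z‖ ^ 2 := mul_le_of_le_one_right (sq_nonneg _) χ.le_one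
      nlinarith [norm_nonneg z]
    · rw [χ.zero_of_le_dist (by simpa using hz)]
      simp [hr]
  refine ⟨e, he1, fun y => inner ℝ e c + √(r ^ 2 - ‖y - P c‖ ^ 2 * χ (y - P c)), ?_, r / 2,
    by positivity, fun x hx => ?_⟩
  · have h1 : ContDiff ℝ 1 fun y : (ℝ ∙ e)ᗮ => y - P c := contDiff_id.sub contDiff_const
    refine contDiff_const.add (ContDiff.sqrt ?_ fun y => (hpos _).ne')
    exact contDiff_const.sub ((h1.norm_sq ℝ).mul (χ.contDiff.comp h1))
  · rw [mem_ball_iff_norm] at hx ⊢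
    have hxc : x - c = (x - p) + r • e := by rw [← hpe]; abel
    have hPx : P x - P c = P (x - p) := by
      rw [← map_sub, hxc, map_add, map_smul, hPe, smul_zero, add_zero]
    have hPle : ‖P x - P c‖ ≤ ‖x - p‖ := by
      rw [hPx]; exact (ℝ ∙ e)ᗮ.norm_orthogonalProjectionOnto_apply_le _
    have hχ : χ (P x - P c) = 1 := by
      apply χ.one_of_mem_closedBall
      rw [mem_closedBall_zero_iff]
      exact hPle.trans hx.le
    have hinner : 0 < (inner ℝ e (x - c) : ℝ) := by
      rw [hxc, inner_add_right, real_inner_smul_right, real_inner_self_eq_norm_sq, he1]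
      have := (abs_le.1 (abs_real_inner_le_norm e (x - p))).1
      rw [he1] at this
      linarith
    have hpyth : ‖x - c‖ ^ 2 = (inner ℝ e (x - c)) ^ 2 + ‖P x - P c‖ ^ 2 := by
      have h1 := (ℝ ∙ e).norm_sq_eq_add_norm_sq_starProjection (x - c)
      rw [Submodule.starProjection_unit_singleton ℝ he1, norm_smul, he1, mul_one,
        Real.norm_eq_abs, sq_abs] at h1
      rw [h1, ← map_sub]
      rfl
    simp only [← hP]
    rw [hχ, mul_one, ← sub_lt_iff_lt_add', ← inner_sub_right, Real.lt_sqrt hinner.le,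
      ← sq_lt_sq₀ (norm_nonneg _) hr.le, hpyth]
    constructor <;> intro h <;> linarith

theorem isBoundedC1Domain_ball {N : ℕ} (c : E N) {r : ℝ} (hr : 0 < r) :
    IsBoundedC1Domain (Metric.ball c r) where
  isOpen := Metric.isOpen_ball
  isConnected := ⟨Metric.nonempty_ball.2 hr, (convex_ball c r).isPreconnected⟩
  isBounded := Metric.isBounded_ball
  hasC1Boundary := hasC1Boundary_ball c hr

theorem fderiv_coord_sub {N : ℕ} (i : Fin N) (a : ℝ) (x v : E N) :
    fderiv ℝ (fun x : E N => x i - a) x v = v i := by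
  have h1 : HasFDerivAt (fun x : E N => x i - a) (EuclideanSpace.proj i : E N →L[ℝ] ℝ) x :=
    ((EuclideanSpace.proj i : E N →L[ℝ] ℝ).hasFDerivAt).sub_const a
  rw [h1.fderiv]; rfl

theorem contDiff_coord {N : ℕ} (i : Fin N) {n : WithTop ℕ∞} : ContDiff ℝ n fun x : E N => x i :=
  (EuclideanSpace.proj i : E N →L[ℝ] ℝ).contDiff

theorem sum_sq_sub_eq {N : ℕ} (x c : E N) : ∑ i, (x i - c i) ^ 2 = ‖x - c‖ ^ 2 := by
  rw [EuclideanSpace.real_norm_sq_eq]; rfl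

/-- One half of the divergence theorem on a ball: the flux inequality for `F + M (x - c)`, compared
with the known flux of `M (x - c)` as `M → ∞`. -/
theorem mul_integral_divergence_ball_le {N : ℕ} (hN : 1 ≤ N) (c : E N) {r : ℝ} (hr : 0 < r)
    {F : Fin N → E N → ℝ} (hF : ∀ i, ContDiff ℝ 1 (F i)) :
    r * ∫ x in Metric.ball c r, divergence F x ≤
      ∫ x, ∑ i, F i x * (x i - c i) ∂(surfaceMeasure (Metric.ball c r)) := by
  have hB := isBoundedC1Domain_ball c hr
  have := hB.isFiniteMeasure
  have hFc : ∀ i, Continuous (F i) := fun i => (hF i).continuous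
  set σ := surfaceMeasure (Metric.ball c r) with hσ
  set C := ∫ x, ∑ i, (F i x) ^ 2 ∂σ with hC
  set J := ∫ x, ∑ i, F i x * (x i - c i) ∂σ with hJ
  have hC0 : 0 ≤ C := integral_nonneg fun x => Finset.sum_nonneg fun i _ => sq_nonneg _
  have hM : ∀ M > 0, r * ∫ x in Metric.ball c r, divergence F x ≤ J + C / (2 * M) := by
    intro M hM
    have h1 := integral_divergence_le hB (F := fun i x => F i x + M * (x i - c i))
      fun i => (hF i).add (contDiff_const.mul ((contDiff_coord i).sub contDiff_const))
    have hdiv : ∀ x, divergence (fun i x => F i x + M * (x i - c i)) x =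
        divergence F x + M * N := by
      intro x
      simp only [divergence]
      rw [Finset.sum_congr rfl (g := fun i => fderiv ℝ (F i) x (stdVec i) + M),
        Finset.sum_add_distrib]
      · simp [mul_comm]
      · intro i _
        have d2 : DifferentiableAt ℝ (fun x : E N => x i - c i) x :=
          (((contDiff_coord (n := 1) i).sub contDiff_const).differentiable one_ne_zero) x
        rw [fderiv_fun_add ((hF i).differentiable one_ne_zero x) (d2.const_mul M),
          fderiv_const_mul d2]
        simp only [add_apply, smul_apply, fderiv_coord_sub]
        simp [stdVec]
    simp only [hdiv] at h1
    rw [integral_add (integrableOn_of_isBounded hB.isBounded (continuous_divergence hF))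
      (integrableOn_of_isBounded hB.isBounded continuous_const), setIntegral_const,
      smul_eq_mul] at h1
    have h2 : ∫ x, √(∑ i, (F i x + M * (x i - c i)) ^ 2) ∂σ ≤
        ∫ x, (M * r + r⁻¹ * ∑ i, F i x * (x i - c i) + (2 * M * r)⁻¹ * ∑ i, (F i x) ^ 2) ∂σ := by
      refine setIntegral_mono_on (hB.integrable_surface (by fun_prop))
        (hB.integrable_surface (by fun_prop)) isClosed_frontier.measurableSet fun x hx => ?_
      rw [frontier_ball c hr.ne', mem_sphere_iff_norm] at hx
      set a := ∑ i, F i x * (x i - c i)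
      set b := ∑ i, (F i x) ^ 2
      have hb : 0 ≤ b := Finset.sum_nonneg fun i _ => sq_nonneg _
      have hexp : ∑ i, (F i x + M * (x i - c i)) ^ 2 = b + 2 * M * a + M ^ 2 * r ^ 2 := by
        rw [← hx, ← sum_sq_sub_eq, Finset.mul_sum, Finset.mul_sum, ← Finset.sum_add_distrib,
          ← Finset.sum_add_distrib]
        exact Finset.sum_congr rfl fun i _ => by ring
      have hnn : 0 ≤ b + 2 * M * a + M ^ 2 * r ^ 2 := by
        rw [← hexp]; exact Finset.sum_nonneg fun i _ => sq_nonneg _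
      have hid : M * r + r⁻¹ * a + (2 * M * r)⁻¹ * b =
          ((b + 2 * M * a + M ^ 2 * r ^ 2) + M ^ 2 * r ^ 2) / (2 * M * r) := by
        field_simp; ring
      -- `√X ≤ (X + A²) / (2A)` with `A = M r`
      rw [hexp, hid, le_div_iff₀ (by positivity)]
      nlinarith [Real.sq_sqrt hnn, sq_nonneg (√(b + 2 * M * a + M ^ 2 * r ^ 2) - M * r)]
    have i1 : Integrable (fun x => r⁻¹ * ∑ i, F i x * (x i - c i)) σ :=
      hB.integrable_surface (by fun_prop)
    have i2 : Integrable (fun x => (2 * M * r)⁻¹ * ∑ i, (F i x) ^ 2) σ :=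
      hB.integrable_surface (by fun_prop)
    have i0 : Integrable (fun x => M * r + r⁻¹ * ∑ i, F i x * (x i - c i)) σ :=
      hB.integrable_surface (by fun_prop)
    rw [integral_add i0 i2, integral_add (integrable_const _) i1,
      integral_const_mul r⁻¹, integral_const_mul (2 * M * r)⁻¹, integral_const, smul_eq_mul,
      ← hC, ← hJ] at h2
    have h3 := surfaceMeasure_ball_le hN c hr
    have h4 := h1.trans h2
    have h5 : r * ∫ x in Metric.ball c r, divergence F x ≤
        r * (σ.real Set.univ * (M * r) + r⁻¹ * J + (2 * M * r)⁻¹ * C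
          - volume.real (Metric.ball c r) * (M * N)) :=
      mul_le_mul_of_nonneg_left (by linarith) hr.le
    have h6 : r * (σ.real Set.univ * (M * r) + r⁻¹ * J + (2 * M * r)⁻¹ * C
          - volume.real (Metric.ball c r) * (M * N)) =
        M * r * (r * σ.real Set.univ - N * volume.real (Metric.ball c r)) + J + C / (2 * M) := by
      field_simp; ring
    have h7 : M * r * (r * σ.real Set.univ - N * volume.real (Metric.ball c r)) ≤ 0 :=
      mul_nonpos_of_nonneg_of_nonpos (by positivity) (by linarith)
    linarith
  refine le_of_forall_pos_le_add fun ε hε => ?_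
  refine (hM ((C + 1) / ε) (by positivity)).trans ?_
  have : C / (2 * ((C + 1) / ε)) ≤ ε := by
    rw [div_le_iff₀ (by positivity)]
    have : ε * (2 * ((C + 1) / ε)) = 2 * (C + 1) := by field_simp
    linarith
  linarith

/-- The divergence theorem on a ball. -/
theorem integral_sphere_eq {N : ℕ} (hN : 1 ≤ N) (c : E N) {r : ℝ} (hr : 0 < r)
    {F : Fin N → E N → ℝ} (hF : ∀ i, ContDiff ℝ 1 (F i)) :
    ∫ x, ∑ i, F i x * (x i - c i) ∂(surfaceMeasure (Metric.ball c r)) =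
      r * ∫ x in Metric.ball c r, divergence F x := by
  refine le_antisymm ?_ (mul_integral_divergence_ball_le hN c hr hF)
  have h := mul_integral_divergence_ball_le hN c hr (F := fun i x => - F i x) fun i => (hF i).neg
  have hdiv : ∀ x, divergence (fun i x => - F i x) x = - divergence F x := fun x => by
    simp only [divergence]
    rw [← Finset.sum_neg_distrib]
    exact Finset.sum_congr rfl fun i _ => by rw [fderiv_fun_neg]; rfl
  simp only [hdiv, neg_mul, Finset.sum_neg_distrib, integral_neg] at h
  linarith

/-! ### Algebra of harmonic polynomials -/

open MvPolynomial in
theorem totalDegree_pderiv_le {ι : Type*} (i : ι) (p : MvPolynomial ι ℝ) :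
    (pderiv i p).totalDegree ≤ p.totalDegree - 1 := by
  refine Finset.sup_le fun m hm => ?_
  rw [mem_support_iff, coeff_pderiv] at hm
  have h1 := le_totalDegree (mem_support_iff.2 (left_ne_zero_of_mul hm))
  have h2 : (m + Finsupp.single i 1).sum (fun _ e => e) = m.sum (fun _ e => e) + 1 := by
    rw [Finsupp.sum_add_index' (by simp) (by simp), Finsupp.sum_single_index rfl]
  have h3 : m.degree = m.sum (fun _ e => e) := rfl
  omega

open MvPolynomial in
theorem pderiv_comm {ι : Type*} (i j : ι) (p : MvPolynomial ι ℝ) :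
    pderiv i (pderiv j p) = pderiv j (pderiv i p) := by
  rcases eq_or_ne i j with rfl | hij
  · rfl
  ext m
  simp only [coeff_pderiv]
  rw [add_right_comm m]
  simp [Finsupp.single_eq_of_ne hij, Finsupp.single_eq_of_ne hij.symm]
  ring

/-- The Laplacian on polynomials, as a linear map. -/
def lap {N : ℕ} : MvPolynomial (Fin N) ℝ →ₗ[ℝ] MvPolynomial (Fin N) ℝ :=
  ∑ i, (MvPolynomial.pderiv i).toLinearMap ∘ₗ (MvPolynomial.pderiv i).toLinearMap

/-- The Euler operator `∑ Xᵢ ∂ᵢ`, that is, `|x|` times the radial derivative. -/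
def euler {N : ℕ} : Derivation ℝ (MvPolynomial (Fin N) ℝ) (MvPolynomial (Fin N) ℝ) :=
  ∑ i, (MvPolynomial.X i : MvPolynomial (Fin N) ℝ) • MvPolynomial.pderiv i

/-- The squared length of the gradient of a polynomial. -/
def gradSq {N : ℕ} (p : MvPolynomial (Fin N) ℝ) : MvPolynomial (Fin N) ℝ :=
  ∑ i, (MvPolynomial.pderiv i p) ^ 2

/-- The polynomial `r² - |x|²`. -/
def sphereDefect (N : ℕ) (r : ℝ) : MvPolynomial (Fin N) ℝ :=
  MvPolynomial.C (r ^ 2) - ∑ i, (MvPolynomial.X i) ^ 2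

section Algebra

open MvPolynomial

variable {N : ℕ}

theorem lap_apply (p : MvPolynomial (Fin N) ℝ) : lap p = ∑ i, pderiv i (pderiv i p) := by
  simp [lap]

theorem euler_apply (p : MvPolynomial (Fin N) ℝ) : euler p = ∑ i, X i * pderiv i p := by
  have h := map_sum (Derivation.coeFnAddMonoidHom (R := ℝ) (A := MvPolynomial (Fin N) ℝ)
    (M := MvPolynomial (Fin N) ℝ)) (fun i : Fin N => (X i : MvPolynomial (Fin N) ℝ) • pderiv i)
    Finset.univ
  have h' := congrFun h p
  rw [Finset.sum_apply] at h'
  exact h'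

theorem coeff_euler (p : MvPolynomial (Fin N) ℝ) (m : Fin N →₀ ℕ) :
    coeff m (euler p) = m.degree * coeff m p := by
  induction p using MvPolynomial.induction_on' with
  | monomial n a =>
    rw [euler_apply]
    simp only [X_mul_pderiv_monomial]
    rw [← Finset.sum_smul, ← Finsupp.degree_eq_sum, coeff_smul, nsmul_eq_mul]
    by_cases h : n = m
    · rw [h]
    · simp [coeff_monomial, h]
  | add p q hp hq => rw [map_add, coeff_add, coeff_add, hp, hq]; ring

/-- Without its constant term, a polynomial lies in the range of the Euler operator, which acts on
monomials of degree `k` as multiplication by `k`. -/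
theorem exists_euler_eq (p : MvPolynomial (Fin N) ℝ) :
    ∃ h, euler h = p - C (coeff 0 p) := by
  classical
  refine ⟨∑ m ∈ p.support, monomial m (coeff m p / m.degree), ?_⟩
  ext m
  have hc : coeff m (∑ m ∈ p.support, monomial m (coeff m p / (m.degree : ℝ))) =
      coeff m p / m.degree := by
    simp only [coeff_sum, coeff_monomial]
    rw [Finset.sum_ite_eq']
    split_ifs with h
    · rfl
    · rw [notMem_support_iff.1 h, zero_div]
  rw [coeff_euler, hc, coeff_sub, coeff_C]
  by_cases hm : m = 0
  · simp [hm]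
  · have : (m.degree : ℝ) ≠ 0 := by
      rw [Nat.cast_ne_zero]; exact fun h => hm ((Finsupp.degree_eq_zero_iff m).1 h)
    rw [if_neg (Ne.symm hm), sub_zero, mul_div_cancel₀ _ this]

theorem pderiv_euler (i : Fin N) (p : MvPolynomial (Fin N) ℝ) :
    pderiv i (euler p) = pderiv i p + euler (pderiv i p) := by
  rw [euler_apply, euler_apply, map_sum]
  simp only [pderiv_mul, pderiv_comm i]
  rw [Finset.sum_add_distrib]
  congr 1
  simp [pderiv_X, Pi.single_apply]

theorem lap_euler (p : MvPolynomial (Fin N) ℝ) : lap (euler p) = euler (lap p) + 2 * lap p := by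
  simp only [lap_apply, pderiv_euler, map_add, map_sum, Finset.mul_sum]
  rw [← Finset.sum_add_distrib]
  exact Finset.sum_congr rfl fun i _ => by ring

theorem lap_eq_zero_of_lap_euler {p : MvPolynomial (Fin N) ℝ} (h : lap (euler p) = 0) :
    lap p = 0 := by
  rw [lap_euler] at h
  ext m
  have h1 := congrArg (coeff m) h
  have h2 : (2 : MvPolynomial (Fin N) ℝ) = C 2 := (map_ofNat C 2).symm
  rw [h2, coeff_add, coeff_euler, coeff_C_mul, coeff_zero, ← add_mul] at h1
  rw [coeff_zero]
  exact (mul_eq_zero.1 h1).resolve_left (by positivity)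

/-- Pointwise form of the Rellich identity: `∇(x · ∇h) · ∇h = |∇h|² + ½ x · ∇|∇h|²`. -/
theorem sum_pderiv_euler_mul (p : MvPolynomial (Fin N) ℝ) :
    ∑ i, pderiv i (euler p) * pderiv i p = gradSq p + C (1 / 2) * euler (gradSq p) := by
  have h : euler (gradSq p) = ∑ i, 2 * (euler (pderiv i p) * pderiv i p) := by
    rw [gradSq, map_sum]
    refine Finset.sum_congr rfl fun i _ => ?_
    rw [sq, Derivation.leibniz, smul_eq_mul]; ring
  rw [h, gradSq, Finset.mul_sum, ← Finset.sum_add_distrib]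
  refine Finset.sum_congr rfl fun i _ => ?_
  have h2 : (C (1 / 2) : MvPolynomial (Fin N) ℝ) * 2 = 1 := by
    rw [← map_ofNat (C : ℝ →+* MvPolynomial (Fin N) ℝ) 2, ← C_mul]; norm_num
  rw [pderiv_euler, ← mul_assoc, h2]
  ring

/-- The Bochner formula for a harmonic polynomial. -/
theorem lap_gradSq {p : MvPolynomial (Fin N) ℝ} (hp : lap p = 0) :
    lap (gradSq p) = 2 * ∑ i, gradSq (pderiv i p) := by
  have h1 : ∀ i, lap (pderiv i p) = 0 := fun i => by
    have : lap (pderiv i p) = pderiv i (lap p) := by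
      simp only [lap_apply, map_sum]
      exact Finset.sum_congr rfl fun j _ => by rw [pderiv_comm j i, pderiv_comm j i]
    rw [this, hp, map_zero]
  rw [gradSq, map_sum, Finset.mul_sum]
  refine Finset.sum_congr rfl fun i _ => ?_
  set q := pderiv i p
  have h2 : lap (q ^ 2) = 2 * gradSq q + 2 * (q * lap q) := by
    simp only [lap_apply, gradSq, Finset.mul_sum]
    rw [← Finset.sum_add_distrib]
    refine Finset.sum_congr rfl fun j _ => ?_
    rw [sq q, pderiv_mul, map_add, pderiv_mul, pderiv_mul]; ring
  rw [h2, h1]; ring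

theorem totalDegree_lap_le (p : MvPolynomial (Fin N) ℝ) :
    (lap p).totalDegree ≤ p.totalDegree - 2 := by
  rw [lap_apply]
  refine totalDegree_finsetSum_le fun i _ => ?_
  have h1 := totalDegree_pderiv_le i (pderiv i p)
  have h2 := totalDegree_pderiv_le i p
  omega

theorem totalDegree_sphereDefect_le (N : ℕ) (r : ℝ) : (sphereDefect N r).totalDegree ≤ 2 := by
  refine (totalDegree_sub _ _).trans (max_le ((totalDegree_C _).trans_le (by norm_num))
    (totalDegree_finsetSum_le fun i _ => ?_))
  exact (totalDegree_pow _ _).trans (by simp)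

/-- The value at `x` of a polynomial in the coordinates centred at `c`. -/
def ev (c : E N) (p : MvPolynomial (Fin N) ℝ) (x : E N) : ℝ := eval (fun i => x i - c i) p

theorem ev_euler (c : E N) (p : MvPolynomial (Fin N) ℝ) (x : E N) :
    ev c (euler p) x = ∑ i, (x i - c i) * ev c (pderiv i p) x := by
  simp [ev, euler_apply]

theorem ev_sphereDefect (c : E N) (r : ℝ) (x : E N) :
    ev c (sphereDefect N r) x = r ^ 2 - ‖x - c‖ ^ 2 := by
  rw [← sum_sq_sub_eq]
  simp [ev, sphereDefect]

theorem contDiff_ev (c : E N) (p : MvPolynomial (Fin N) ℝ) {n : WithTop ℕ∞} :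
    ContDiff ℝ n (ev c p) := by
  unfold ev
  induction p using MvPolynomial.induction_on with
  | C a => simpa using contDiff_const
  | add p q hp hq => simpa using hp.add hq
  | mul_X p i hp => simpa using hp.mul ((contDiff_coord i).sub contDiff_const)

theorem fderiv_ev (c : E N) (p : MvPolynomial (Fin N) ℝ) (i : Fin N) (x : E N) :
    fderiv ℝ (ev c p) x (stdVec i) = ev c (pderiv i p) x := by
  have hd : ∀ p : MvPolynomial (Fin N) ℝ, DifferentiableAt ℝ (ev c p) x := fun p =>
    (contDiff_ev c p (n := 1)).differentiable one_ne_zero x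
  induction p using MvPolynomial.induction_on with
  | C a =>
    have : ev c (C a) = fun _ => a := by ext; simp [ev]
    rw [this]; simp [ev]
  | add p q hp hq =>
    have : ev c (p + q) = fun x => ev c p x + ev c q x := by ext; simp [ev]
    rw [this, fderiv_fun_add (hd p) (hd q), add_apply, hp, hq]; simp [ev]
  | mul_X p j hp =>
    have h1 : ev c (p * X j) = fun x => ev c p x * (x j - c j) := by ext; simp [ev]
    have h2 : DifferentiableAt ℝ (fun x : E N => x j - c j) x :=
      (((contDiff_coord (n := 1) j).sub contDiff_const).differentiable one_ne_zero) x
    rw [h1, fderiv_fun_mul (hd p) h2, add_apply, smul_apply, smul_apply, fderiv_coord_sub, hp]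
    simp only [ev, pderiv_mul, pderiv_X, smul_eq_mul, map_add, map_mul, eval_X, stdVec]
    by_cases hij : i = j
    · subst hij; simp; ring
    · simp [Ne.symm hij]; ring

/-- A polynomial function vanishing on a ball comes from the zero polynomial. -/
theorem eq_zero_of_ev_eq_zero {c : E N} {r : ℝ} (hr : 0 < r) {p : MvPolynomial (Fin N) ℝ}
    (h : ∀ x ∈ Metric.ball c r, ev c p x = 0) : p = 0 := by
  have hδ : 0 < r / (N + 1) := by positivity
  refine MvPolynomial.funext_set (fun _ => Set.Ioo (-(r / (N + 1))) (r / (N + 1)))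
    (fun i => Set.Ioo_infinite (by linarith)) fun y hy => ?_
  have hx := h (c + WithLp.toLp 2 y) (by
    rw [mem_ball_iff_norm, add_sub_cancel_left, ← sq_lt_sq₀ (norm_nonneg _) hr.le,
      EuclideanSpace.real_norm_sq_eq]
    calc ∑ i, y i ^ 2 ≤ ∑ _i : Fin N, (r / (N + 1)) ^ 2 := by
          refine Finset.sum_le_sum fun i _ => ?_
          have := hy i (Set.mem_univ i)
          exact sq_le_sq' this.1.le this.2.le
      _ = N * (r / (N + 1)) ^ 2 := by simp
      _ < r ^ 2 := by
          rw [div_pow, mul_div_assoc', div_lt_iff₀ (by positivity)]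
          have : (0 : ℝ) ≤ N := by positivity
          nlinarith [sq_pos_of_pos hr, mul_nonneg this this])
  simpa [ev] using hx

end Algebra

/-! ### The Steklov inequality on a ball -/

section Ball

open MvPolynomial

variable {N : ℕ}

theorem continuous_fderiv_stdVec {w : E N → ℝ} (hw : ContDiff ℝ 1 w) (i : Fin N) :
    Continuous fun x => fderiv ℝ w x (stdVec i) :=
  (hw.continuous_fderiv one_ne_zero).clm_apply continuous_const

theorem continuous_ev (c : E N) (p : MvPolynomial (Fin N) ℝ) : Continuous (ev c p) :=
  (contDiff_ev c p (n := 0)).continuous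

/-- Green's formula on a ball. -/
theorem integral_sphere_mul_euler (hN : 1 ≤ N) (c : E N) {r : ℝ} (hr : 0 < r) {w : E N → ℝ}
    (hw : ContDiff ℝ 1 w) (p : MvPolynomial (Fin N) ℝ) :
    ∫ x, w x * ev c (euler p) x ∂(surfaceMeasure (Metric.ball c r)) =
      r * ∫ x in Metric.ball c r, ((∑ i, fderiv ℝ w x (stdVec i) * ev c (pderiv i p) x)
        + w x * ev c (lap p) x) := by
  have h := integral_sphere_eq hN c hr (F := fun i x => w x * ev c (pderiv i p) x)
    fun i => hw.mul (contDiff_ev c _)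
  have h1 : ∀ x, ∑ i, w x * ev c (pderiv i p) x * (x i - c i) = w x * ev c (euler p) x := by
    intro x
    rw [ev_euler, Finset.mul_sum]
    exact Finset.sum_congr rfl fun i _ => by ring
  have h2 : ∀ x, divergence (fun i x => w x * ev c (pderiv i p) x) x =
      (∑ i, fderiv ℝ w x (stdVec i) * ev c (pderiv i p) x) + w x * ev c (lap p) x := by
    intro x
    have h3 : ev c (lap p) x = ∑ i, ev c (pderiv i (pderiv i p)) x := by simp [ev, lap_apply]
    rw [divergence, h3, Finset.mul_sum, ← Finset.sum_add_distrib]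
    refine Finset.sum_congr rfl fun i _ => ?_
    rw [fderiv_fun_mul (hw.differentiable one_ne_zero x)
      ((contDiff_ev c (pderiv i p) (n := 1)).differentiable one_ne_zero x), add_apply, smul_apply,
      smul_apply, fderiv_ev, smul_eq_mul, smul_eq_mul]
    ring
  simp only [h1, h2] at h
  exact h

/-- Uniqueness for the Dirichlet problem: a harmonic polynomial vanishing on the sphere has zero
energy in the ball by Green's formula. -/
theorem eq_zero_of_lap_sphereDefect_mul (hN : 1 ≤ N) {r : ℝ} (hr : 0 < r)
    {q : MvPolynomial (Fin N) ℝ} (hq : lap (sphereDefect N r * q) = 0) : q = 0 := by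
  set g := sphereDefect N r * q with hg
  set B := Metric.ball (0 : E N) r with hB
  have hbd : Bornology.IsBounded B := Metric.isBounded_ball
  have hgreen := integral_sphere_mul_euler hN 0 hr (contDiff_ev 0 g) g
  have hzero : ∫ x, ev 0 g x * ev 0 (euler g) x ∂(surfaceMeasure B) = 0 := by
    rw [← integral_zero (E N) ℝ (μ := surfaceMeasure B)]
    refine setIntegral_congr_fun isClosed_frontier.measurableSet fun x hx => ?_
    rw [hB, frontier_ball _ hr.ne', mem_sphere_iff_norm] at hx
    have : ev 0 g x = ev 0 (sphereDefect N r) x * ev 0 q x := by simp [ev, hg]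
    simp only [this, ev_sphereDefect, hx, sub_self, zero_mul]
  have h0 : ∀ x, ev (0 : E N) (0 : MvPolynomial (Fin N) ℝ) x = 0 := fun x => by simp [ev]
  rw [hzero, hq] at hgreen
  simp only [fderiv_ev, h0, mul_zero, add_zero] at hgreen
  have hI := (mul_eq_zero.1 hgreen.symm).resolve_left hr.ne'
  have hcont : Continuous fun x : E N => ∑ i, ev 0 (pderiv i g) x * ev 0 (pderiv i g) x :=
    continuous_finsetSum _ fun i _ => (continuous_ev _ _).mul (continuous_ev _ _)
  have hnn : ∀ x : E N, 0 ≤ ∑ i, ev 0 (pderiv i g) x * ev 0 (pderiv i g) x :=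
    fun x => Finset.sum_nonneg fun i _ => mul_self_nonneg _
  have hae := (setIntegral_eq_zero_iff_of_nonneg_ae (Eventually.of_forall hnn)
    (integrableOn_of_isBounded hbd hcont)).1 hI
  have hall : Set.EqOn (fun x : E N => ∑ i, ev 0 (pderiv i g) x * ev 0 (pderiv i g) x) 0 B :=
    Measure.eqOn_open_of_ae_eq hae Metric.isOpen_ball hcont.continuousOn continuousOn_const
  have hpd : ∀ i, pderiv i g = 0 := fun i => by
    refine eq_zero_of_ev_eq_zero hr (c := 0) fun x hx => ?_
    have h1 := (Finset.sum_eq_zero_iff_of_nonneg fun i _ => mul_self_nonneg _).1 (hall hx) i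
      (Finset.mem_univ i)
    exact mul_self_eq_zero.1 h1
  have heu : euler g = 0 := by rw [euler_apply]; simp [hpd]
  have hgC : g = C (coeff 0 g) := by
    ext m
    rw [coeff_C]
    split_ifs with hm
    · rw [hm]
    · have h1 := coeff_euler g m
      rw [heu, coeff_zero] at h1
      exact (mul_eq_zero.1 h1.symm).resolve_left
        (Nat.cast_ne_zero.2 fun h => hm ((Finsupp.degree_eq_zero_iff m).1 h).symm)
  -- the constant is zero because `g` vanishes at the point `r e₀` of the sphere
  have hg0 : g = 0 := by
    have h1 : ev 0 g (EuclideanSpace.single ⟨0, hN⟩ r : E N) = 0 := by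
      have : ev 0 g (EuclideanSpace.single ⟨0, hN⟩ r : E N) =
        ev 0 (sphereDefect N r) (EuclideanSpace.single ⟨0, hN⟩ r : E N) *
          ev 0 q (EuclideanSpace.single ⟨0, hN⟩ r : E N) := by simp [ev, hg]
      rw [this, ev_sphereDefect]
      simp
    rw [hgC] at h1 ⊢
    have h2 : coeff 0 g = 0 := by simpa [ev] using h1
    rw [h2, C_0]
  refine (mul_eq_zero.1 hg0).resolve_left fun h => ?_
  have h1 := ev_sphereDefect (0 : E N) r 0
  rw [h, h0] at h1
  simp only [sub_self, norm_zero, ne_eq, OfNat.ofNat_ne_zero, not_false_eq_true, zero_pow,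
    sub_zero] at h1
  exact (pow_pos hr 2).ne h1

/-- Every polynomial agrees on the sphere with a harmonic polynomial: the map
`q ↦ Δ((r² - |x|²) q)` does not raise degrees and is injective, hence surjective. -/
theorem exists_harmonic_eq_on_sphere (hN : 1 ≤ N) (c : E N) {r : ℝ} (hr : 0 < r)
    (p : MvPolynomial (Fin N) ℝ) :
    ∃ p', lap p' = 0 ∧ ∀ x ∈ Metric.sphere c r, ev c p' x = ev c p x := by
  set n := p.totalDegree with hn
  let T : restrictTotalDegree (Fin N) ℝ n →ₗ[ℝ] restrictTotalDegree (Fin N) ℝ n :=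
    LinearMap.restrict (lap ∘ₗ LinearMap.mulLeft ℝ (sphereDefect N r)) fun q hq => by
      rw [mem_restrictTotalDegree] at hq ⊢
      refine (totalDegree_lap_le _).trans ?_
      have h1 := totalDegree_mul (sphereDefect N r) q
      have h2 := totalDegree_sphereDefect_le N r
      simp only [LinearMap.mulLeft_apply]
      omega
  have hinj : Function.Injective T := by
    rw [← LinearMap.ker_eq_bot, LinearMap.ker_eq_bot']
    intro q hq
    exact Subtype.ext (eq_zero_of_lap_sphereDefect_mul hN hr (congrArg Subtype.val hq))
  obtain ⟨q, hq⟩ := LinearMap.injective_iff_surjective.1 hinj ⟨lap p, by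
    rw [mem_restrictTotalDegree]
    exact (totalDegree_lap_le p).trans (Nat.sub_le _ _)⟩
  have hq' : lap (sphereDefect N r * (q : MvPolynomial (Fin N) ℝ)) = lap p :=
    congrArg Subtype.val hq
  refine ⟨p - sphereDefect N r * (q : MvPolynomial (Fin N) ℝ), by rw [map_sub, hq', sub_self],
    fun x hx => ?_⟩
  have h1 : ev c (p - sphereDefect N r * (q : MvPolynomial (Fin N) ℝ)) x =
      ev c p x - ev c (sphereDefect N r) x * ev c q x := by
    simp [ev]
  rw [mem_sphere_iff_norm] at hx
  rw [h1, ev_sphereDefect, hx, sub_self, zero_mul, sub_zero]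

/-- Polynomials are uniformly dense in the continuous functions on a sphere. -/
theorem exists_ev_near (c : E N) (r : ℝ) {w : E N → ℝ} (hw : Continuous w) {ε : ℝ} (hε : 0 < ε) :
    ∃ p, ∀ x ∈ Metric.sphere c r, |ev c p x - w x| ≤ ε := by
  let S := Metric.sphere c r
  have : CompactSpace S := isCompact_iff_compactSpace.1 (isCompact_sphere c r)
  let Φ : MvPolynomial (Fin N) ℝ →ₐ[ℝ] C(S, ℝ) :=
    aeval fun i => (⟨fun x => (x : E N) i - c i, by fun_prop⟩ : C(S, ℝ))
  have hΦ : ∀ p (x : S), Φ p x = ev c p x := by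
    intro p x
    induction p using MvPolynomial.induction_on with
    | C a => simp [Φ, ev]
    | add p q hp hq => simp only [map_add, ContinuousMap.add_apply, hp, hq]; simp [ev]
    | mul_X p i hp => simp only [map_mul, ContinuousMap.mul_apply, hp]; simp [ev, Φ]
  have hsep : Φ.range.SeparatesPoints := by
    intro x y hxy
    obtain ⟨i, hi⟩ : ∃ i, (x : E N) i ≠ (y : E N) i := by
      by_contra! h
      exact hxy (Subtype.ext (by ext i; exact h i))
    refine ⟨_, ⟨Φ (X i), ⟨X i, rfl⟩, rfl⟩, ?_⟩
    change Φ (X i) x ≠ Φ (X i) y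
    rw [hΦ, hΦ]
    simpa [ev] using hi
  obtain ⟨⟨g, p, rfl⟩, hg⟩ := ContinuousMap.exists_mem_subalgebra_near_continuous_of_separatesPoints
    Φ.range hsep (fun x => w x) (by fun_prop) ε hε
  refine ⟨p, fun x hx => ?_⟩
  have := hg ⟨x, hx⟩
  rw [Real.norm_eq_abs] at this
  have h2 : Φ p ⟨x, hx⟩ = ev c p x := hΦ p ⟨x, hx⟩
  rw [← h2]
  exact this.le

/-- For a harmonic polynomial `h` the energy `∫ |∇h|²` in the ball is at most `r⁻¹` times the
squared `L²` norm of `x · ∇h` on the sphere. By the Rellich identity the difference is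
`½ ∫ x · ∇|∇h|² = ¼ ∫ (r² - |x|²) Δ|∇h|²`, and `|∇h|²` is subharmonic. -/
theorem integral_gradSq_le (hN : 1 ≤ N) (c : E N) {r : ℝ} (hr : 0 < r)
    {h : MvPolynomial (Fin N) ℝ} (hh : lap h = 0) :
    r * ∫ x in Metric.ball c r, ev c (gradSq h) x ≤
      ∫ x, (ev c (euler h) x) ^ 2 ∂(surfaceMeasure (Metric.ball c r)) := by
  have hbd : Bornology.IsBounded (Metric.ball c r) := Metric.isBounded_ball
  have e0 : ∀ x, ev c (0 : MvPolynomial (Fin N) ℝ) x = 0 := fun x => by simp [ev]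
  have h1 := integral_sphere_mul_euler hN c hr (contDiff_ev c (euler h)) h
  have h2 := integral_sphere_mul_euler hN c hr (contDiff_ev c (sphereDefect N r)) (gradSq h)
  have hz : ∫ x, ev c (sphereDefect N r) x * ev c (euler (gradSq h)) x
      ∂(surfaceMeasure (Metric.ball c r)) = 0 := by
    rw [← integral_zero (E N) ℝ (μ := surfaceMeasure (Metric.ball c r))]
    refine setIntegral_congr_fun isClosed_frontier.measurableSet fun x hx => ?_
    rw [frontier_ball _ hr.ne', mem_sphere_iff_norm] at hx
    simp only [ev_sphereDefect, hx, sub_self, zero_mul]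
  have hr1 : ∀ x, (∑ i, fderiv ℝ (ev c (euler h)) x (stdVec i) * ev c (pderiv i h) x)
      + ev c (euler h) x * ev c (lap h) x =
      ev c (gradSq h) x + 1 / 2 * ev c (euler (gradSq h)) x := by
    intro x
    rw [hh, e0, mul_zero, add_zero]
    have := congrArg (fun p => ev c p x) (sum_pderiv_euler_mul h)
    simp only [fderiv_ev]
    simpa [ev] using this
  have hr2 : ∀ x, (∑ i, fderiv ℝ (ev c (sphereDefect N r)) x (stdVec i) *
      ev c (pderiv i (gradSq h)) x) + ev c (sphereDefect N r) x * ev c (lap (gradSq h)) x =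
      ev c (sphereDefect N r) x * ev c (lap (gradSq h)) x - 2 * ev c (euler (gradSq h)) x := by
    intro x
    have hd : ∀ i, pderiv i (sphereDefect N r) = - (2 * X i) := by
      intro i
      simp [sphereDefect, pderiv_X, Pi.single_apply]
    rw [ev_euler, Finset.mul_sum, add_comm, sub_eq_add_neg, ← Finset.sum_neg_distrib]
    congr 1
    refine Finset.sum_congr rfl fun i _ => ?_
    rw [fderiv_ev, hd]
    simp [ev]; ring
  have hnn : 0 ≤ ∫ x in Metric.ball c r, ev c (sphereDefect N r) x * ev c (lap (gradSq h)) x := by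
    refine setIntegral_nonneg Metric.isOpen_ball.measurableSet fun x hx => ?_
    rw [mem_ball_iff_norm] at hx
    rw [ev_sphereDefect, lap_gradSq hh]
    refine mul_nonneg (by nlinarith [norm_nonneg (x - c)]) ?_
    simp only [ev, gradSq, map_mul, map_sum, map_pow, map_ofNat]
    positivity
  simp only [hr1] at h1
  simp only [hr2, hz] at h2
  have i1 : IntegrableOn (ev c (gradSq h)) (Metric.ball c r) :=
    integrableOn_of_isBounded hbd (continuous_ev _ _)
  have i2 : IntegrableOn (ev c (euler (gradSq h))) (Metric.ball c r) :=
    integrableOn_of_isBounded hbd (continuous_ev _ _)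
  have i3 : IntegrableOn (fun x => ev c (sphereDefect N r) x * ev c (lap (gradSq h)) x)
      (Metric.ball c r) :=
    integrableOn_of_isBounded hbd ((continuous_ev _ _).mul (continuous_ev _ _))
  rw [integral_sub i3 (i2.const_mul 2), integral_const_mul] at h2
  rw [integral_add i1 (i2.const_mul _), integral_const_mul] at h1
  have h3 := (mul_eq_zero.1 h2.symm).resolve_left hr.ne'
  have h4 : 0 ≤ ∫ x in Metric.ball c r, ev c (euler (gradSq h)) x := by linarith
  simp only [sq, h1]
  nlinarith

/-- The Steklov inequality on a ball: the first nonzero Steklov eigenvalue of the Laplacian on a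
ball of radius `r` is `1 / r`. -/
theorem steklov_ball (hN : 1 ≤ N) (c : E N) {r : ℝ} (hr : 0 < r) {w : E N → ℝ}
    (hw : ContDiff ℝ 1 w) (hw0 : ∫ x, w x ∂(surfaceMeasure (Metric.ball c r)) = 0) :
    ∫ x, (w x) ^ 2 ∂(surfaceMeasure (Metric.ball c r)) ≤
      r * ∫ x in Metric.ball c r, ∑ i, (fderiv ℝ w x (stdVec i)) ^ 2 := by
  have hB := isBoundedC1Domain_ball c hr
  have := hB.isFiniteMeasure
  set σ := surfaceMeasure (Metric.ball c r) with hσ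
  have e0 : ∀ x, ev c (0 : MvPolynomial (Fin N) ℝ) x = 0 := fun x => by simp [ev]
  have hwc := hw.continuous
  have key : ∀ ε > 0, ∫ x, (w x) ^ 2 ∂σ ≤
      r * (∫ x in Metric.ball c r, ∑ i, (fderiv ℝ w x (stdVec i)) ^ 2) +
        ε ^ 2 * σ.real Set.univ := by
    intro ε hε
    obtain ⟨p₀, hp₀⟩ := exists_ev_near c r hwc hε
    obtain ⟨p, hp, hpp⟩ := exists_harmonic_eq_on_sphere hN c hr p₀
    obtain ⟨h, hh⟩ := exists_euler_eq p
    set k := coeff 0 p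
    have hlap : lap h = 0 := by
      refine lap_eq_zero_of_lap_euler ?_
      rw [hh, map_sub, hp, zero_sub, neg_eq_zero, lap_apply]
      simp
    have hv : ∀ x, ev c (euler h) x = ev c p x - k := fun x => by rw [hh]; simp [ev]
    have hvc : Continuous (ev c (euler h)) := continuous_ev _ _
    have hpc : Continuous (ev c p) := continuous_ev _ _
    -- `v = x · ∇h` has mean zero and differs from `p` by the constant `k`
    have g1 := integral_sphere_mul_euler hN c hr (w := fun _ => (1 : ℝ)) contDiff_const h
    have g2 := integral_sphere_mul_euler hN c hr hw h
    simp only [hlap, e0, mul_zero, add_zero, one_mul, fderiv_fun_const, Pi.zero_apply,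
      zero_apply, zero_mul, Finset.sum_const_zero, integral_zero] at g1 g2
    have g3 := integral_gradSq_le hN c hr hlap
    have hdiff : ∫ x, (w x - ev c (euler h) x) ^ 2 ∂σ ≤ ε ^ 2 * σ.real Set.univ := by
      have i1 : Integrable (fun x => (w x - ev c p x) ^ 2) σ :=
        hB.integrable_surface (by fun_prop)
      have i2 : Integrable (fun x => 2 * k * (w x - ev c (euler h) x)) σ :=
        hB.integrable_surface (by fun_prop)
      have i3 : Integrable (fun x => (w x - ev c p x) ^ 2 + 2 * k * (w x - ev c (euler h) x)) σ :=
        hB.integrable_surface (by fun_prop)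
      have hid : ∀ x, (w x - ev c (euler h) x) ^ 2 =
          (w x - ev c p x) ^ 2 + 2 * k * (w x - ev c (euler h) x) - k ^ 2 := fun x => by
        rw [hv]; ring
      have hmean : ∫ x, (w x - ev c (euler h) x) ∂σ = 0 := by
        rw [integral_sub (hB.integrable_surface hwc) (hB.integrable_surface hvc), hw0, g1, sub_zero]
      simp only [hid]
      rw [integral_sub i3 (integrable_const _), integral_add i1 i2, integral_const_mul, hmean,
        integral_const, smul_eq_mul]
      have hle : ∫ x, (w x - ev c p x) ^ 2 ∂σ ≤ ∫ _x, ε ^ 2 ∂σ := by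
        refine setIntegral_mono_on i1 (integrable_const (μ := σ) (ε ^ 2))
          isClosed_frontier.measurableSet fun x hx => ?_
        rw [frontier_ball _ hr.ne'] at hx
        rw [hpp x hx, ← sq_abs, abs_sub_comm]
        have := hp₀ x hx
        gcongr
      rw [integral_const, smul_eq_mul] at hle
      have : 0 ≤ σ.real Set.univ * k ^ 2 := by positivity
      linarith
    have hexp : ∫ x, (w x - ev c (euler h) x) ^ 2 ∂σ = ∫ x, (w x) ^ 2 ∂σ -
        2 * (∫ x, w x * ev c (euler h) x ∂σ) + ∫ x, (ev c (euler h) x) ^ 2 ∂σ := by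
      have i1 : Integrable (fun x => (w x) ^ 2) σ := hB.integrable_surface (by fun_prop)
      have i2 : Integrable (fun x => 2 * (w x * ev c (euler h) x)) σ :=
        hB.integrable_surface (by fun_prop)
      have i3 : Integrable (fun x => (ev c (euler h) x) ^ 2) σ :=
        hB.integrable_surface (by fun_prop)
      have i4 : Integrable (fun x => (w x) ^ 2 - 2 * (w x * ev c (euler h) x)) σ :=
        hB.integrable_surface (by fun_prop)
      rw [← integral_const_mul, ← integral_sub i1 i2, ← integral_add i4 i3]
      congr 1; ext x; ring
    have hdw := continuous_fderiv_stdVec hw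
    have hpd : ∀ i, Continuous (ev c (pderiv i h)) := fun i => continuous_ev _ _
    have henergy : 2 * (∫ x in Metric.ball c r, ∑ i, fderiv ℝ w x (stdVec i) * ev c (pderiv i h) x)
        - ∫ x in Metric.ball c r, ev c (gradSq h) x ≤
        ∫ x in Metric.ball c r, ∑ i, (fderiv ℝ w x (stdVec i)) ^ 2 := by
      have j1 : IntegrableOn (fun x => 2 * ∑ i, fderiv ℝ w x (stdVec i) * ev c (pderiv i h) x)
        (Metric.ball c r) := integrableOn_of_isBounded Metric.isBounded_ball (by fun_prop)
      have j2 : IntegrableOn (ev c (gradSq h)) (Metric.ball c r) :=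
        integrableOn_of_isBounded Metric.isBounded_ball (continuous_ev _ _)
      have j3 : IntegrableOn (fun x => ∑ i, (fderiv ℝ w x (stdVec i)) ^ 2) (Metric.ball c r) :=
        integrableOn_of_isBounded Metric.isBounded_ball (by fun_prop)
      rw [← integral_const_mul, ← integral_sub j1 j2]
      refine integral_mono (j1.sub j2) j3 fun x => ?_
      have hgs : ev c (gradSq h) x = ∑ i, (ev c (pderiv i h) x) ^ 2 := by simp [ev, gradSq]
      simp only [hgs]
      rw [Finset.mul_sum, ← Finset.sum_sub_distrib]
      refine Finset.sum_le_sum fun i _ => ?_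
      nlinarith [sq_nonneg (fderiv ℝ w x (stdVec i) - ev c (pderiv i h) x)]
    have := mul_le_mul_of_nonneg_left henergy hr.le
    rw [hexp, g2] at hdiff
    nlinarith
  have hlim : Tendsto (fun ε : ℝ => r * (∫ x in Metric.ball c r,
      ∑ i, (fderiv ℝ w x (stdVec i)) ^ 2) + ε ^ 2 * σ.real Set.univ) (𝓝[>] 0)
      (𝓝 (r * (∫ x in Metric.ball c r, ∑ i, (fderiv ℝ w x (stdVec i)) ^ 2) +
        0 ^ 2 * σ.real Set.univ)) := by
    have hc : Continuous fun ε : ℝ => r * (∫ x in Metric.ball c r,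
      ∑ i, (fderiv ℝ w x (stdVec i)) ^ 2) + ε ^ 2 * σ.real Set.univ := by fun_prop
    exact (hc.tendsto 0).mono_left nhdsWithin_le_nhds
  have h1 := ge_of_tendsto hlim (by
    filter_upwards [self_mem_nhdsWithin] with ε hε using key ε hε)
  simpa using h1

end Ball

/-! ### Lower bound for the fundamental tone of a ball -/

/-- Integrals of products pass to the limit under `L²` convergence of both factors. -/
theorem tendsto_integral_mul_of_tendsto_eLpNorm {α : Type*} [MeasurableSpace α] {μ : Measure α}
    {f g : α → ℝ} {F G : ℕ → α → ℝ} (hf : MemLp f 2 μ) (hg : MemLp g 2 μ)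
    (hF : ∀ n, MemLp (F n) 2 μ) (hG : ∀ n, MemLp (G n) 2 μ)
    (hFf : Tendsto (fun n => eLpNorm (fun x => F n x - f x) 2 μ) atTop (𝓝 0))
    (hGg : Tendsto (fun n => eLpNorm (fun x => G n x - g x) 2 μ) atTop (𝓝 0)) :
    Tendsto (fun n => ∫ x, F n x * G n x ∂μ) atTop (𝓝 (∫ x, f x * g x ∂μ)) := by
  have hinner : ∀ {f g : α → ℝ} (hf : MemLp f 2 μ) (hg : MemLp g 2 μ),
      inner ℝ (hg.toLp g) (hf.toLp f) = ∫ x, f x * g x ∂μ := by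
    intro f g hf hg
    rw [L2.inner_def]
    refine integral_congr_ae ?_
    filter_upwards [hf.coeFn_toLp, hg.coeFn_toLp] with x h1 h2
    rw [h1, h2]; rfl
  have h1 := (Lp.tendsto_Lp_iff_tendsto_eLpNorm'' F hF f hf).2 hFf
  have h2 := (Lp.tendsto_Lp_iff_tendsto_eLpNorm'' G hG g hg).2 hGg
  have h3 := Filter.Tendsto.inner (𝕜 := ℝ) h2 h1
  simpa only [hinner] using h3

theorem mul_surfaceMeasure_ball {N : ℕ} (hN : 1 ≤ N) (c : E N) {r : ℝ} (hr : 0 < r) :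
    r * (surfaceMeasure (Metric.ball c r)).real Set.univ = N * volume.real (Metric.ball c r) := by
  have h := integral_sphere_eq hN c hr (F := fun i x => x i - c i)
    fun i => (contDiff_coord i).sub contDiff_const
  have h1 : ∫ x, ∑ i, (x i - c i) * (x i - c i) ∂(surfaceMeasure (Metric.ball c r)) =
      ∫ _x, r ^ 2 ∂(surfaceMeasure (Metric.ball c r)) := by
    refine setIntegral_congr_fun isClosed_frontier.measurableSet fun x hx => ?_
    rw [frontier_ball _ hr.ne', mem_sphere_iff_norm] at hx
    simp only [← sq, sum_sq_sub_eq, hx]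
  have h2 : ∀ x, divergence (fun i (x : E N) => x i - c i) x = N := fun x => by
    simp [divergence, fderiv_coord_sub, stdVec]
  simp only [h2, h1, integral_const, measureReal_restrict_apply_univ, smul_eq_mul] at h
  have h3 : r * (r * (surfaceMeasure (Metric.ball c r)).real Set.univ) =
      r * (N * volume.real (Metric.ball c r)) := by linarith
  exact mul_left_cancel₀ hr.ne' h3

theorem surfaceMeasure_ball_pos {N : ℕ} (hN : 1 ≤ N) (c : E N) {r : ℝ} (hr : 0 < r) :
    0 < (surfaceMeasure (Metric.ball c r)).real Set.univ := by
  have h := mul_surfaceMeasure_ball hN c hr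
  have h1 : 0 < volume.real (Metric.ball c r) :=
    ENNReal.toReal_pos (Metric.measure_ball_pos _ _ hr).ne' Metric.isBounded_ball.measure_lt_top.ne
  have h2 : (0 : ℝ) < N := by exact_mod_cast hN
  have h3 : 0 < r * (surfaceMeasure (Metric.ball c r)).real Set.univ := by
    rw [h]; positivity
  exact (mul_pos_iff_of_pos_left hr).1 h3

/-- The Steklov inequality applied to `w` minus its mean, cleared of denominators and written with
products so as to pass to `L²` limits. -/
theorem steklov_ball_variance {N : ℕ} (hN : 1 ≤ N) (c : E N) {r : ℝ} (hr : 0 < r) {w : E N → ℝ}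
    (hw : ContDiff ℝ 1 w) :
    (surfaceMeasure (Metric.ball c r)).real Set.univ *
        ∫ x, w x * w x ∂(surfaceMeasure (Metric.ball c r)) -
      (∫ x, w x * 1 ∂(surfaceMeasure (Metric.ball c r))) ^ 2 ≤
      (surfaceMeasure (Metric.ball c r)).real Set.univ *
        (r * ∑ i, ∫ x in Metric.ball c r, fderiv ℝ w x (stdVec i) * fderiv ℝ w x (stdVec i)) := by
  have hB := isBoundedC1Domain_ball c hr
  have := hB.isFiniteMeasure
  have hs := surfaceMeasure_ball_pos hN c hr
  set σ := surfaceMeasure (Metric.ball c r) with hσ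
  set s := σ.real Set.univ with hsdef
  set m := (∫ x, w x ∂σ) / s with hm
  have hms : ∫ x, w x ∂σ = m * s := by rw [hm]; field_simp
  have hwc := hw.continuous
  have i1 : Integrable w σ := hB.integrable_surface hwc
  have i2 : Integrable (fun x => w x * w x) σ := hB.integrable_surface (by fun_prop)
  have i3 : Integrable (fun x => w x * w x - 2 * m * w x) σ := hB.integrable_surface (by fun_prop)
  have h := steklov_ball hN c hr (w := fun x => w x - m) (hw.sub contDiff_const) (by
    rw [integral_sub i1 (integrable_const _), integral_const, smul_eq_mul, hms]; ring)
  have hdw := continuous_fderiv_stdVec hw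
  have i4 : ∀ i ∈ Finset.univ, IntegrableOn
      (fun x => fderiv ℝ w x (stdVec i) * fderiv ℝ w x (stdVec i)) (Metric.ball c r) :=
    fun i _ => integrableOn_of_isBounded Metric.isBounded_ball ((hdw i).mul (hdw i))
  have hexp : ∀ x, (w x - m) ^ 2 = w x * w x - 2 * m * w x + m ^ 2 := fun x => by ring
  simp only [hexp, fderiv_sub_const, sq (fderiv ℝ w _ _)] at h
  rw [integral_add i3 (integrable_const _), integral_sub i2 (i1.const_mul _), integral_const_mul,
    integral_const, hms, smul_eq_mul, integral_finsetSum _ i4] at h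
  simp only [mul_one, hms]
  have := mul_le_mul_of_nonneg_left h hs.le
  nlinarith

/-- The Steklov inequality on a ball for Sobolev functions and their traces. -/
theorem steklov_ball_trace {N : ℕ} (hN : 1 ≤ N) (c : E N) {r : ℝ} (hr : 0 < r)
    {u t : E N → ℝ} {g : Fin N → E N → ℝ}
    (hg : ∀ i, MemLp (g i) 2 (volume.restrict (Metric.ball c r)))
    (ht : IsTrace (Metric.ball c r) u g t)
    (ht0 : ∫ x, t x ∂(surfaceMeasure (Metric.ball c r)) = 0) :
    ∫ x, (t x) ^ 2 ∂(surfaceMeasure (Metric.ball c r)) ≤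
      r * ∫ x in Metric.ball c r, ∑ i, (g i x) ^ 2 := by
  have hB := isBoundedC1Domain_ball c hr
  have := hB.isFiniteMeasure
  have hs := surfaceMeasure_ball_pos hN c hr
  obtain ⟨htL, w, hw, -, hwg, hwt⟩ := ht
  have hw1 : ∀ n, ContDiff ℝ 1 (w n) := fun n => (hw n).of_le (by norm_cast)
  set σ := surfaceMeasure (Metric.ball c r) with hσ
  have hwσ : ∀ n, MemLp (w n) 2 σ := fun n => hB.memLp_surface (hw n).continuous 2
  have hdw : ∀ i n, MemLp (fun x => fderiv ℝ (w n) x (stdVec i)) 2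
      (volume.restrict (Metric.ball c r)) := fun i n =>
    memLp_of_isBounded Metric.isBounded_ball (continuous_fderiv_stdVec (hw1 n) i) 2
  have l1 := tendsto_integral_mul_of_tendsto_eLpNorm htL htL hwσ hwσ hwt hwt
  have l2 := tendsto_integral_mul_of_tendsto_eLpNorm htL (memLp_const (1 : ℝ)) hwσ
    (fun _ => memLp_const (1 : ℝ)) hwt (by simp)
  have l3 := tendsto_finsetSum Finset.univ fun i (_ : i ∈ Finset.univ) =>
    tendsto_integral_mul_of_tendsto_eLpNorm (hg i) (hg i) (hdw i) (hdw i) (hwg i) (hwg i)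
  have h := le_of_tendsto_of_tendsto' ((l1.const_mul (σ.real Set.univ)).sub (l2.pow 2))
    ((l3.const_mul r).const_mul (σ.real Set.univ)) fun n => steklov_ball_variance hN c hr (hw1 n)
  simp only [mul_one, ht0] at h
  rw [zero_pow two_ne_zero, sub_zero, mul_le_mul_iff_right₀ hs] at h
  simp only [sq]
  have hgi : ∀ i ∈ Finset.univ, IntegrableOn (fun x => g i x * g i x) (Metric.ball c r) :=
    fun i _ => (hg i).integrable_mul (hg i)
  rwa [integral_finsetSum _ hgi]

theorem div_le_of_mem_rayleighQuotients_ball {N : ℕ} (hN : 1 ≤ N) {τ : ℝ} (hτ : 0 < τ) (c : E N)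
    {r : ℝ} (hr : 0 < r) {q : ℝ} (hq : q ∈ rayleighQuotients τ (Metric.ball c r)) : τ / r ≤ q := by
  obtain ⟨u, g, h, t, hu, ht, ht0, ht2, rfl⟩ := hq
  have hst := steklov_ball_trace hN c hr hu.memLp_grad ht ht0
  have hpos : 0 < ∫ x, (t x) ^ 2 ∂(surfaceMeasure (Metric.ball c r)) :=
    lt_of_le_of_ne (integral_nonneg fun x => sq_nonneg _) (Ne.symm ht2)
  have i1 : IntegrableOn (fun x => ∑ i, (g i x) ^ 2) (Metric.ball c r) :=
    integrable_finsetSum _ fun i _ => (hu.memLp_grad i).integrable_sq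
  have i2 : IntegrableOn (fun x => ∑ i, ∑ j, (h i j x) ^ 2) (Metric.ball c r) :=
    integrable_finsetSum _ fun i _ => integrable_finsetSum _ fun j _ =>
      (hu.memLp_hess i j).integrable_sq
  rw [integral_add i2 (i1.const_mul τ), integral_const_mul, div_le_div_iff₀ hr hpos]
  have h2 : 0 ≤ ∫ x in Metric.ball c r, ∑ i, ∑ j, (h i j x) ^ 2 :=
    integral_nonneg fun x => Finset.sum_nonneg fun i _ => Finset.sum_nonneg fun j _ => sq_nonneg _
  have := mul_le_mul_of_nonneg_left hst hτ.le
  nlinarith [mul_nonneg hr.le h2]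

/-! ### Upper bound by a weighted isoperimetric inequality -/

/-- Among sets of the same measure, `B` minimizes the integral of a function that is at most `K` on
`B` and at least `K` outside. -/
theorem setIntegral_le_setIntegral_of_measure_eq {N : ℕ} {A B : Set (E N)} (hA : MeasurableSet A)
    (hB : MeasurableSet B) (hfin : volume A ≠ ⊤) (hAB : volume B = volume A) {k : E N → ℝ} {K : ℝ}
    (hkA : IntegrableOn k A) (hkB : IntegrableOn k B) (h1 : ∀ x ∈ B, k x ≤ K)
    (h2 : ∀ x ∉ B, K ≤ k x) : ∫ x in B, k x ≤ ∫ x in A, k x := by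
  have iA : IntegrableOn (fun x => k x - K) A := hkA.sub (integrableOn_const hfin)
  have iB : IntegrableOn (fun x => k x - K) B := hkB.sub (integrableOn_const (hAB ▸ hfin))
  have e1 := integral_inter_add_sdiff hB iA
  have e2 := integral_inter_add_sdiff hA iB
  have p1 : 0 ≤ ∫ x in A \ B, (k x - K) :=
    setIntegral_nonneg (hA.diff hB) fun x hx => sub_nonneg.2 (h2 x hx.2)
  have p2 : ∫ x in B \ A, (k x - K) ≤ 0 :=
    setIntegral_nonpos (hB.diff hA) fun x hx => sub_nonpos.2 (h1 x hx.1)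
  rw [Set.inter_comm] at e2
  have hle : ∫ x in B, (k x - K) ≤ ∫ x in A, (k x - K) := by linarith
  rw [integral_sub hkA (integrableOn_const hfin),
    integral_sub hkB (integrableOn_const (hAB ▸ hfin)), setIntegral_const, setIntegral_const,
    Measure.real, Measure.real, hAB] at hle
  linarith

/-- The components of the calibrating field `φ(|x - a|²) (x - a)` with `φ(s) = 2 r s / (s + r²)`.
Its length is at most `|x - a|²`, with equality on the sphere of radius `r`, where it is normal.
The factor `φ` is chosen rational so that the field is smooth at `a`. -/
def calibration {N : ℕ} (a : E N) (r : ℝ) (i : Fin N) (x : E N) : ℝ :=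
  2 * r * ‖x - a‖ ^ 2 / (‖x - a‖ ^ 2 + r ^ 2) * (x i - a i)

theorem contDiff_calibration {N : ℕ} (a : E N) {r : ℝ} (hr : 0 < r) (i : Fin N) :
    ContDiff ℝ 1 (calibration a r i) := by
  have h1 : ContDiff ℝ 1 fun x : E N => ‖x - a‖ ^ 2 := (contDiff_id.sub contDiff_const).norm_sq ℝ
  exact ((contDiff_const.mul h1).div (h1.add contDiff_const) fun x => by positivity).mul
    ((contDiff_coord i).sub contDiff_const)

theorem divergence_calibration {N : ℕ} (a : E N) {r : ℝ} (hr : 0 < r) (x : E N) :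
    divergence (calibration a r) x =
      2 * r * (‖x - a‖ ^ 2 * (N * ‖x - a‖ ^ 2 + (N + 2) * r ^ 2)) / (‖x - a‖ ^ 2 + r ^ 2) ^ 2 := by
  set s := ‖x - a‖ ^ 2 with hs
  have hsr : s + r ^ 2 ≠ 0 := by positivity
  have hφ : HasDerivAt (fun s : ℝ => 2 * r * s / (s + r ^ 2))
      ((2 * r * 1 * (s + r ^ 2) - 2 * r * s * 1) / (s + r ^ 2) ^ 2) s :=
    ((hasDerivAt_id s).const_mul (2 * r)).fun_div ((hasDerivAt_id s).add_const (r ^ 2)) hsr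
  have hn : HasFDerivAt (fun x : E N => ‖x - a‖ ^ 2) _ x :=
    (((hasFDerivAt_id x).sub_const a).norm_sq)
  have hc := hφ.comp_hasFDerivAt x hn
  have hi : ∀ i, fderiv ℝ (calibration a r i) x (stdVec i) =
      (2 * r * s / (s + r ^ 2)) + (x i - a i) ^ 2 * (4 * r ^ 3 / (s + r ^ 2) ^ 2) := by
    intro i
    have hd : DifferentiableAt ℝ (fun x : E N => x i - a i) x :=
      (((contDiff_coord (n := 1) i).sub contDiff_const).differentiable one_ne_zero) x
    have hm := (hc.mul hd.hasFDerivAt).fderiv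
    have he : calibration a r i = ((fun s : ℝ => 2 * r * s / (s + r ^ 2)) ∘
      fun x : E N => ‖x - a‖ ^ 2) * fun x : E N => x i - a i := rfl
    rw [he, hm]
    simp only [add_apply, smul_apply, fderiv_coord_sub, smul_eq_mul, Function.comp_apply, ← hs]
    simp [stdVec, EuclideanSpace.inner_single_right]
    field_simp
    ring
  simp only [divergence, hi]
  rw [Finset.sum_add_distrib, ← Finset.sum_mul, sum_sq_sub_eq, ← hs]
  simp
  field_simp
  ring

/-- Among sets of given volume, balls centred at `a` minimize `∫ |x - a|² dσ`; the bound is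
`r² σ(∂B) = r N |B|`. -/
theorem mul_volume_le_integral_norm_sq {N : ℕ} (hN : 2 ≤ N) {Ω : Set (E N)}
    (hΩ : IsBoundedC1Domain Ω) (c a : E N) {r : ℝ} (hr : 0 < r)
    (hvol : volume (Metric.ball c r) = volume Ω) :
    r * (N * volume.real Ω) ≤ ∫ x, ∑ i, (x i - a i) ^ 2 ∂(surfaceMeasure Ω) := by
  have hN1 : 1 ≤ N := by omega
  have hva : volume (Metric.ball a r) = volume Ω := by
    rw [← hvol, Measure.addHaar_ball_center, Measure.addHaar_ball_center volume c]
  have hCd : ∀ i, ContDiff ℝ 1 (calibration a r i) := contDiff_calibration a hr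
  have h1 := integral_divergence_le hΩ hCd
  have h2 : ∫ x, √(∑ i, (calibration a r i x) ^ 2) ∂(surfaceMeasure Ω) ≤
      ∫ x, ∑ i, (x i - a i) ^ 2 ∂(surfaceMeasure Ω) := by
    have hcc : ∀ i, Continuous (calibration a r i) := fun i => (hCd i).continuous
    refine integral_mono (hΩ.integrable_surface (by fun_prop))
      (hΩ.integrable_surface (by fun_prop)) fun x => ?_
    simp only [calibration, mul_pow]
    rw [← Finset.mul_sum, sum_sq_sub_eq]
    refine Real.sqrt_le_iff.2 ⟨sq_nonneg _, ?_⟩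
    set n := ‖x - a‖
    have hn : 0 ≤ n := norm_nonneg _
    have h3 : 2 * r * n ^ 2 / (n ^ 2 + r ^ 2) ≤ n := by
      rw [div_le_iff₀ (by positivity)]
      nlinarith [mul_nonneg hn (sq_nonneg (n - r))]
    have h4 : 0 ≤ 2 * r * n ^ 2 / (n ^ 2 + r ^ 2) := by positivity
    calc (2 * r * n ^ 2 / (n ^ 2 + r ^ 2)) ^ 2 * n ^ 2 ≤ n ^ 2 * n ^ 2 := by gcongr
      _ = (n ^ 2) ^ 2 := by ring
  have h3 : ∫ x in Metric.ball a r, divergence (calibration a r) x ≤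
      ∫ x in Ω, divergence (calibration a r) x := by
    -- for `N ≥ 2` the divergence is an increasing function of `|x - a|`
    have hmono : ∀ s t : ℝ, 0 ≤ s → s ≤ t →
        2 * r * (s * (N * s + (N + 2) * r ^ 2)) / (s + r ^ 2) ^ 2 ≤
        2 * r * (t * (N * t + (N + 2) * r ^ 2)) / (t + r ^ 2) ^ 2 := by
      intro s t hs hst
      have ht : 0 ≤ t := hs.trans hst
      rw [div_le_div_iff₀ (by positivity) (by positivity)]
      have hN2 : (0 : ℝ) ≤ N - 2 := by
        have : (2 : ℝ) ≤ N := by exact_mod_cast hN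
        linarith
      have hd : 0 ≤ 2 * r * ((t - s) * ((N - 2) * r ^ 2 * (t * s) + N * r ^ 4 * (t + s)
          + (N + 2) * r ^ 6)) :=
        mul_nonneg (by positivity) (mul_nonneg (by linarith) (by positivity))
      nlinarith
    refine setIntegral_le_setIntegral_of_measure_eq
      (K := 2 * r * (r ^ 2 * (N * r ^ 2 + (N + 2) * r ^ 2)) / (r ^ 2 + r ^ 2) ^ 2)
      hΩ.isOpen.measurableSet Metric.isOpen_ball.measurableSet
      hΩ.isBounded.measure_lt_top.ne hva
      (integrableOn_of_isBounded hΩ.isBounded (continuous_divergence hCd))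
      (integrableOn_of_isBounded Metric.isBounded_ball (continuous_divergence hCd))
      (fun x hx => ?_) (fun x hx => ?_)
    · rw [mem_ball_iff_norm] at hx
      rw [divergence_calibration a hr]
      exact hmono _ _ (sq_nonneg _) (by gcongr)
    · rw [mem_ball_iff_norm, not_lt] at hx
      rw [divergence_calibration a hr]
      exact hmono _ _ (sq_nonneg _) (by gcongr)
  have h4 := integral_sphere_eq hN1 a hr hCd
  have h5 : ∫ x, ∑ i, calibration a r i x * (x i - a i) ∂(surfaceMeasure (Metric.ball a r)) =
      ∫ _x, r ^ 3 ∂(surfaceMeasure (Metric.ball a r)) := by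
    refine setIntegral_congr_fun isClosed_frontier.measurableSet fun x hx => ?_
    rw [frontier_ball _ hr.ne', mem_sphere_iff_norm] at hx
    simp only [calibration, mul_assoc _ (_ - _ : ℝ), ← sq (_ - _ : ℝ)]
    rw [← Finset.mul_sum, sum_sq_sub_eq, hx]
    field_simp
    ring
  rw [h5, integral_const, smul_eq_mul] at h4
  have h6 := mul_surfaceMeasure_ball hN1 a hr
  have h7 : volume.real (Metric.ball a r) = volume.real Ω := by rw [Measure.real, Measure.real, hva]
  rw [h7] at h6
  have h8 : r * (r * (N * volume.real Ω)) =
      r * ∫ x in Metric.ball a r, divergence (calibration a r) x := by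
    rw [← h4, ← h6]; ring
  have h9 := mul_left_cancel₀ hr.ne' h8
  linarith

theorem isWeakPartialDeriv_of_contDiff {N : ℕ} {Ω : Set (E N)} (i : Fin N) {u : E N → ℝ}
    (hu : ContDiff ℝ 1 u) : IsWeakPartialDeriv Ω i u fun x => fderiv ℝ u x (stdVec i) := by
  intro φ hφ hφc hφs
  have hφ1 : ContDiff ℝ 1 φ := hφ.of_le (by norm_cast)
  have hout : ∀ x, x ∉ Ω → x ∉ tsupport φ := fun x hx h => hx (hφs h)
  have hdc : HasCompactSupport fun x => fderiv ℝ φ x (stdVec i) :=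
    hφc.fderiv_apply (𝕜 := ℝ) (stdVec i)
  have c1 := continuous_fderiv_stdVec hu i
  have c2 := continuous_fderiv_stdVec hφ1 i
  rw [setIntegral_eq_integral_of_forall_compl_eq_zero fun x hx => by
      rw [image_eq_zero_of_notMem_tsupport fun h => hout x hx (tsupport_fderiv_subset ℝ h)]; simp,
    setIntegral_eq_integral_of_forall_compl_eq_zero fun x hx => by
      rw [image_eq_zero_of_notMem_tsupport (hout x hx), mul_zero]]
  exact integral_mul_fderiv_eq_neg_fderiv_mul_of_integrable
    ((c1.mul hφ1.continuous).integrable_of_hasCompactSupport hφc.mul_left)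
    ((hu.continuous.mul c2).integrable_of_hasCompactSupport hdc.mul_left)
    ((hu.continuous.mul hφ1.continuous).integrable_of_hasCompactSupport hφc.mul_left)
    (fun x _ => hu.differentiable one_ne_zero x) (fun x _ => hφ1.differentiable one_ne_zero x)

/-- A coordinate function with mean zero on `∂Ω` is an admissible test function; its Hessian
vanishes. -/
theorem coord_mem_rayleighQuotients {N : ℕ} (τ : ℝ) {Ω : Set (E N)} (hΩ : IsBoundedC1Domain Ω)
    (i : Fin N) (a : ℝ) (h0 : ∫ x, (x i - a) ∂(surfaceMeasure Ω) = 0)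
    (h2 : ∫ x, (x i - a) ^ 2 ∂(surfaceMeasure Ω) ≠ 0) :
    τ * volume.real Ω / ∫ x, (x i - a) ^ 2 ∂(surfaceMeasure Ω) ∈ rayleighQuotients τ Ω := by
  have hu : ∀ {n : WithTop ℕ∞}, ContDiff ℝ n fun x : E N => x i - a :=
    (contDiff_coord i).sub contDiff_const
  refine ⟨fun x => x i - a, fun j _ => stdVec (N := N) j i, fun _ _ _ => 0, fun x => x i - a,
    ⟨memLp_of_isBounded hΩ.isBounded (hu (n := 0)).continuous 2,
      fun j => memLp_of_isBounded hΩ.isBounded continuous_const 2,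
      fun j k => memLp_of_isBounded hΩ.isBounded continuous_const 2, fun j => ?_, fun j k => ?_⟩,
    ⟨hΩ.memLp_surface (hu (n := 0)).continuous 2, fun _ x => x i - a, fun _ => hu, by simp,
      fun j => by simp [fderiv_coord_sub], by simp⟩, h0, h2, ?_⟩
  · have h := isWeakPartialDeriv_of_contDiff (Ω := Ω) j (hu (n := 1))
    simpa only [fderiv_coord_sub] using h
  · have h := isWeakPartialDeriv_of_contDiff (Ω := Ω) k
      (contDiff_const (𝕜 := ℝ) (n := 1) (E := E N) (c := stdVec (N := N) j i))
    simpa using h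
  · congr 1
    simp [stdVec, mul_comm]

/-- The weighted isoperimetric inequality makes the coordinate functions, centred at the
barycentre of `∂Ω`, good test functions on average. -/
theorem exists_barycentre {N : ℕ} (hN : 2 ≤ N) {Ω : Set (E N)} (hΩ : IsBoundedC1Domain Ω)
    (c : E N) {r : ℝ} (hr : 0 < r) (hvol : volume (Metric.ball c r) = volume Ω) :
    ∃ a : Fin N → ℝ, (∀ i, ∫ x, (x i - a i) ∂(surfaceMeasure Ω) = 0) ∧
      r * (N * volume.real Ω) ≤ ∑ i, ∫ x, (x i - a i) ^ 2 ∂(surfaceMeasure Ω) := by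
  have := hΩ.isFiniteMeasure
  have hvpos : 0 < volume.real Ω := by
    rw [Measure.real, ← hvol]
    exact ENNReal.toReal_pos (Metric.measure_ball_pos _ _ hr).ne'
      Metric.isBounded_ball.measure_lt_top.ne
  have hNpos : (0 : ℝ) < N := by
    have : 0 < N := by omega
    exact_mod_cast this
  have hc : ∀ i, Continuous fun x : E N => x i := fun i => (contDiff_coord (n := 0) i).continuous
  -- nonzero boundary area, by the inequality itself with an arbitrary centre
  have hs : (surfaceMeasure Ω).real Set.univ ≠ 0 := by
    intro h0
    have hz : surfaceMeasure Ω = 0 := by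
      rw [← Measure.measure_univ_eq_zero]
      exact (measureReal_eq_zero_iff (measure_ne_top _ _)).1 h0
    have h1 := mul_volume_le_integral_norm_sq hN hΩ c 0 hr hvol
    rw [hz, integral_zero_measure] at h1
    have : 0 < r * (N * volume.real Ω) := by positivity
    linarith
  refine ⟨fun i => (∫ x, x i ∂(surfaceMeasure Ω)) / (surfaceMeasure Ω).real Set.univ,
    fun i => ?_, ?_⟩
  · rw [integral_sub (hΩ.integrable_surface (hc i)) (integrable_const _), integral_const,
      smul_eq_mul, mul_div_cancel₀ _ hs, sub_self]
  · have h1 := mul_volume_le_integral_norm_sq hN hΩ c (WithLp.toLp 2 fun i =>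
      (∫ x, x i ∂(surfaceMeasure Ω)) / (surfaceMeasure Ω).real Set.univ) hr hvol
    rwa [integral_finsetSum _ fun i _ => hΩ.integrable_surface (by fun_prop)] at h1

theorem nonneg_of_mem_rayleighQuotients {N : ℕ} {τ : ℝ} (hτ : 0 < τ) {Ω : Set (E N)} {q : ℝ}
    (hq : q ∈ rayleighQuotients τ Ω) : 0 ≤ q := by
  obtain ⟨u, g, h, t, -, -, -, -, rfl⟩ := hq
  exact div_nonneg (integral_nonneg fun x => by positivity) (integral_nonneg fun x => sq_nonneg _)

theorem fundamentalTone_nonneg {N : ℕ} {τ : ℝ} (hτ : 0 < τ) (Ω : Set (E N)) :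
    0 ≤ fundamentalTone τ Ω :=
  Real.sInf_nonneg fun _ hq => nonneg_of_mem_rayleighQuotients hτ hq

theorem fundamentalTone_le {N : ℕ} (hN : 2 ≤ N) {τ : ℝ} (hτ : 0 < τ) {Ω : Set (E N)}
    (hΩ : IsBoundedC1Domain Ω) (c : E N) {r : ℝ} (hr : 0 < r)
    (hvol : volume (Metric.ball c r) = volume Ω) : fundamentalTone τ Ω ≤ τ / r := by
  obtain ⟨a, ha0, ha⟩ := exists_barycentre hN hΩ c hr hvol
  have hvpos : 0 < volume.real Ω := by
    rw [Measure.real, ← hvol]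
    exact ENNReal.toReal_pos (Metric.measure_ball_pos _ _ hr).ne'
      Metric.isBounded_ball.measure_lt_top.ne
  have hNpos : (0 : ℝ) < N := by
    have : 0 < N := by omega
    exact_mod_cast this
  set D : Fin N → ℝ := fun i => ∫ x, (x i - a i) ^ 2 ∂(surfaceMeasure Ω) with hD
  have hi : ∀ i, fundamentalTone τ Ω * D i ≤ τ * volume.real Ω := by
    intro i
    by_cases h0 : D i = 0
    · rw [h0, mul_zero]; positivity
    · have hpos : 0 < D i := lt_of_le_of_ne (integral_nonneg fun x => sq_nonneg _) (Ne.symm h0)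
      rw [← le_div_iff₀ hpos]
      exact csInf_le ⟨0, fun _ hq => nonneg_of_mem_rayleighQuotients hτ hq⟩
        (coord_mem_rayleighQuotients τ hΩ i (a i) (ha0 i) h0)
  have hsum : fundamentalTone τ Ω * ∑ i, D i ≤ N * (τ * volume.real Ω) := by
    rw [Finset.mul_sum]
    simpa using Finset.sum_le_sum fun i (_ : i ∈ Finset.univ) => hi i
  have h1 := mul_le_mul_of_nonneg_left ha (fundamentalTone_nonneg hτ Ω)
  rw [le_div_iff₀ hr]
  have h2 : (fundamentalTone τ Ω * r) * (N * volume.real Ω) ≤ τ * (N * volume.real Ω) := by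
    linarith
  exact le_of_mul_le_mul_right h2 (by positivity)

theorem le_fundamentalTone_ball {N : ℕ} (hN : 2 ≤ N) {τ : ℝ} (hτ : 0 < τ) (c : E N) {r : ℝ}
    (hr : 0 < r) : τ / r ≤ fundamentalTone τ (Metric.ball c r) := by
  have hB := isBoundedC1Domain_ball c hr
  -- the infimum is over a nonempty set, so that it is not the default value `0`
  refine le_csInf ?_ fun q hq =>
    div_le_of_mem_rayleighQuotients_ball (by omega) hτ c hr hq
  obtain ⟨a, ha0, ha⟩ := exists_barycentre hN hB c hr rfl
  by_contra hempty
  have hD : ∀ i, ∫ x, (x i - a i) ^ 2 ∂(surfaceMeasure (Metric.ball c r)) = 0 := fun i => by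
    by_contra h
    exact hempty ⟨_, coord_mem_rayleighQuotients τ hB i (a i) (ha0 i) h⟩
  simp only [hD, Finset.sum_const_zero] at ha
  have hvpos : 0 < volume.real (Metric.ball c r) :=
    ENNReal.toReal_pos (Metric.measure_ball_pos _ _ hr).ne' Metric.isBounded_ball.measure_lt_top.ne
  have hNpos : (0 : ℝ) < N := by
    have : 0 < N := by omega
    exact_mod_cast this
  have : 0 < r * (N * volume.real (Metric.ball c r)) := by positivity
  linarith

end SteklovBiharmonic

end

theorem mainTheorem2 (N : ℕ) (hN : 2 ≤ N) (τ : ℝ) (hτ : 0 < τ)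
    (Ω : Set (EuclideanSpace ℝ (Fin N))) (hΩ : SteklovBiharmonic.IsBoundedC1Domain Ω)
    (c : EuclideanSpace ℝ (Fin N)) (r : ℝ) (hr : 0 < r)
    (hvol : volume (Metric.ball c r) = volume Ω) :
    SteklovBiharmonic.IsBoundedC1Domain (Metric.ball c r) ∧
    SteklovBiharmonic.fundamentalTone τ Ω ≤
      SteklovBiharmonic.fundamentalTone τ (Metric.ball c r) := by
  exact ⟨SteklovBiharmonic.isBoundedC1Domain_ball c hr,
    (SteklovBiharmonic.fundamentalTone_le hN hτ hΩ c hr hvol).trans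
      (SteklovBiharmonic.le_fundamentalTone_ball hN hτ c hr)⟩
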